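/- Let $K\ge 1$, let $T,H,\beta_0,\sigma^2,P>0$ and $0<\eta\le 1$, and let $w_1,\dots,w_K\in\mathbb R^2$ be the users' horizontal locations. Put $h_k(q)=\beta_0/(\|q-w_k\|^2+H^2)$ for $q\in\mathbb R^2$ and $\gamma=\beta_0/\sigma^2$. A schedule consists of functions of $t\in(0,T]$: mode indicators $\rho_0,\rho_1,\dots,\rho_K$, powers $Q_1,\dots,Q_K$ and a UAV location $q$ in $\mathbb R^2$. It is admissible if these functions are measurable, $\rho_i(t)\in\{0,1\}$, $\sum_{i=0}^K\rho_i(t)=1$ and $Q_k(t)\ge 0$ for all $t\in(0,T]$, and $\int_0^T\rho_kQ_k\,dt<\infty$ for all $k$. Write $$R_k=\frac1T\int_0^T\rho_k(t)\log_2\Big(1+\frac{Q_k(t)h_k(q(t))}{\sigma^2}\Big)dt,\qquad D_k=\int_0^T\eta P\rho_0(t)h_k(q(t))\,dt-\int_0^T\rho_k(t)Q_k(t)\,dt .$$ Problem (P2) is to maximize $\min_kR_k$ over the admissible schedules with $D_k\ge 0$ for all $k$ (there is no constraint on the speed of the UAV). Its equivalent form (P2.1) is to maximize $R$ over all pairs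 of such a schedule and an $R\in\mathbb R$ with $R_k\ge R$ for all $k$. For $\lambda,\mu\in\mathbb R^K$, the dual function of (P2.1) is $$g(\lambda,\mu)=\sup\Big\{\Big(1-\sum_k\lambda_k\Big)R+\sum_k\lambda_kR_k+\sum_k\mu_kD_k\Big\}\in(-\infty,\infty],$$ the supremum being over all admissible schedules and all $R\in\mathbb R$. The dual problem (D2.1) is to minimize $g(\lambda,\mu)$ subject to $\sum_k\lambda_k=1$, $\lambda_k\ge0$, $\mu_k\ge 0$ for all $k$. Then (D2.1) has an optimal solution. Let $(\lambda^{\rm opt},\mu^{\rm opt})$ be any optimal solution of (D2.1). Then $\mu_k^{\rm opt}>0$ for all $k$, and the set of global maximizers over $\mathbb R^2$ of $$\phi(q,\mu^{\rm opt})=\sum_{k=1}^K\eta P\mu_k^{\rm opt}h_k(q)$$ is finite and nonempty. Let $\bar q_1,\dots,\bar q_\Omega$ be its distinct elements, in any order, and put $\bar Q_k=\Big(\dfrac{\lambda_k^{\rm opt}}{T\mu_k^{\rm opt}\ln2}-\dfrac{H^2}{\gamma}\Big)^+$. The linear program (P2.2) $$\max_{\varsigma_k\ge0,\ \tau_\omega\ge0,\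 R\in\mathbb R}\ R\quad\text{s.t.}\quad \frac{\varsigma_k}{T}\log_2\Big(1+\frac{\bar Q_kh_k(w_k)}{\sigma^2}\Big)\ge R,\quad \varsigma_k\bar Q_k\le\sum_{\omega=1}^\Omega\tau_\omega\eta Ph_k(\bar q_\omega)\quad\forall k,\qquad \sum_{k=1}^K\varsigma_k+\sum_{\omega=1}^\Omega\tau_\omega=T$$ has an optimal solution. For any optimal solution $(\hat\varsigma,\hat\tau,\hat R)$ of (P2.2), there is a schedule on $(0,T]$ with the following properties, and every such schedule, together with $R=\hat R$, is optimal for (P2.1): * for $\omega=1,\dots,\Omega$ and $t\in\big(\sum_{j<\omega}\hat\tau_j,\sum_{j\le\omega}\hat\tau_j\big]$: $q(t)=\bar q_\omega$, $\rho_0(t)=1$, and $\rho_k(t)=Q_k(t)=0$ for all $k$; * for $k=1,\dots,K$ and $t\in\big(\sum_\omega\hat\tau_\omega+\sum_{j<k}\hat\varsigma_j,\ \sum_\omega\hat\tau_\omega+\sum_{j\le k}\hat\varsigma_j\big]$: $q(t)=w_k$, $\rho_k(t)=1$, $Q_k(t)=\bar Q_k$, $\rho_0(t)=0$, and $\rho_j(t)=Q_j(t)=0$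 for all $j\ne k$. Such a schedule is also optimal for (P2), and its common throughput $\min_kR_k$, the optimal common throughput, equals $\hat R$. -/

import Mathlib

open MeasureTheory

noncomputable section

namespace UAV

/-- The horizontal plane with its Euclidean norm. -/
abbrev Plane : Type := EuclideanSpace ℝ (Fin 2)

/-- The parameters of a UAV-enabled wireless powered communication network with `K` ground users:
period `T`, altitude `H`, reference channel gain `β₀`, noise power `σsq` (that is `σ²`), conversion
efficiency `η`, downlink transmit power `P`, and horizontal user locations `w k`. -/
structure Network (K : ℕ) where
  T : ℝ
  H : ℝ
  β₀ : ℝ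
  σsq : ℝ
  η : ℝ
  P : ℝ
  w : Fin K → Plane
  T_pos : 0 < T
  H_pos : 0 < H
  β₀_pos : 0 < β₀
  σsq_pos : 0 < σsq
  η_pos : 0 < η
  η_le_one : η ≤ 1
  P_pos : 0 < P

/-- The decision variables as functions of time: mode indicators `ρ` (index `0` is downlink power
transfer, index `k.succ` is the uplink of user `k`), transmit powers `Q`, and UAV location `q`. -/
structure Schedule (K : ℕ) where
  ρ : Fin (K + 1) → ℝ → ℝ
  Q : Fin K → ℝ → ℝ
  q : ℝ → Plane

namespace Network

variable {K : ℕ} (N : Network K)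

/-- Lebesgue measure on the flight period `(0, T]`. -/
def periodMeasure : Measure ℝ := volume.restrict (Set.Ioc 0 N.T)

/-- Channel power gain `h_k(q)`. -/
def gain (k : Fin K) (q : Plane) : ℝ := N.β₀ / (‖q - N.w k‖ ^ 2 + N.H ^ 2)

/-- Reference signal-to-noise ratio `γ`. -/
def snr : ℝ := N.β₀ / N.σsq

/-- Harvested power `E_k(ρ₀, q)`. -/
def harvest (k : Fin K) (ρ₀ : ℝ) (q : Plane) : ℝ := N.η * N.P * ρ₀ * N.gain k q

/-- Achievable rate `r_k(ρ_k, q, Q_k)`. -/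
def rate (k : Fin K) (ρk : ℝ) (q : Plane) (Qk : ℝ) : ℝ :=
  ρk * Real.logb 2 (1 + Qk * N.gain k q / N.σsq)

/-- Total harvested energy of user `k` over the period. -/
def harvestedEnergy (s : Schedule K) (k : Fin K) : ℝ :=
  ∫ t, N.harvest k (s.ρ 0 t) (s.q t) ∂N.periodMeasure

/-- Total energy consumption of user `k` over the period. -/
def consumedEnergy (s : Schedule K) (k : Fin K) : ℝ :=
  ∫ t, s.ρ k.succ t * s.Q k t ∂N.periodMeasure

/-- Throughput `R_k` of user `k`. -/
def throughput (s : Schedule K) (k : Fin K) : ℝ :=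
  1 / N.T * ∫ t, N.rate k (s.ρ k.succ t) (s.q t) (s.Q k t) ∂N.periodMeasure

/-- The uplink common throughput `min_k R_k`. -/
def commonThroughput (s : Schedule K) : ℝ := ⨅ k, N.throughput s k

/-- The constraints on a schedule other than energy neutrality: binary modes that sum to one and
nonnegative powers at all times of the period. The variables are measurable on the period, and the
consumed energies are finite, so that all the integrals above are genuine. -/
structure Admissible (s : Schedule K) : Prop where
  binary : ∀ i, ∀ t ∈ Set.Ioc 0 N.T, s.ρ i t = 0 ∨ s.ρ i t = 1
  sum_eq_one : ∀ t ∈ Set.Ioc 0 N.T, ∑ i, s.ρ i t = 1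
  power_nonneg : ∀ k, ∀ t ∈ Set.Ioc 0 N.T, 0 ≤ s.Q k t
  measurable_ρ : ∀ i, AEMeasurable (s.ρ i) N.periodMeasure
  measurable_Q : ∀ k, AEMeasurable (s.Q k) N.periodMeasure
  measurable_q : AEMeasurable s.q N.periodMeasure
  integrable : ∀ k, Integrable (fun t => s.ρ k.succ t * s.Q k t) N.periodMeasure

/-- Feasibility for the speed-unconstrained problem: admissible and energy neutral. -/
def Feasible (s : Schedule K) : Prop :=
  N.Admissible s ∧ ∀ k, N.consumedEnergy s k ≤ N.harvestedEnergy s k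

/-- `s` maximizes the common throughput among all feasible schedules. -/
def IsOptimal (s : Schedule K) : Prop :=
  N.Feasible s ∧ ∀ s', N.Feasible s' → N.commonThroughput s' ≤ N.commonThroughput s

/-- Feasibility for the epigraph form with the auxiliary variable `R`. -/
def EpiFeasible (s : Schedule K) (R : ℝ) : Prop :=
  N.Feasible s ∧ ∀ k, R ≤ N.throughput s k

/-- `(s, R)` is an optimal solution of the epigraph form. -/
def IsEpiOptimal (s : Schedule K) (R : ℝ) : Prop :=
  N.EpiFeasible s R ∧ ∀ s' R', N.EpiFeasible s' R' → R' ≤ R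

/-- The partial Lagrangian of the epigraph form. -/
def lagrangian (s : Schedule K) (R : ℝ) (lam mu : Fin K → ℝ) : ℝ :=
  (1 - ∑ k, lam k) * R + ∑ k, lam k * N.throughput s k
    + ∑ k, mu k * (N.harvestedEnergy s k - N.consumedEnergy s k)

/-- The Lagrange dual function, with value `⊤` where the Lagrangian is unbounded. -/
def dual (lam mu : Fin K → ℝ) : EReal :=
  ⨆ (s : Schedule K) (_ : N.Admissible s) (R : ℝ), ((N.lagrangian s R lam mu : ℝ) : EReal)

/-- The feasible set of the dual problem. -/
def DualFeasible (lam mu : Fin K → ℝ) : Prop :=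
  ∑ k, lam k = 1 ∧ (∀ k, 0 ≤ lam k) ∧ ∀ k, 0 ≤ mu k

/-- Optimal solutions of the dual problem. -/
def IsDualOptimal (lam mu : Fin K → ℝ) : Prop :=
  DualFeasible lam mu ∧ ∀ lam' mu', DualFeasible lam' mu' → N.dual lam mu ≤ N.dual lam' mu'

/-- `φ(q, μ) = ∑ₖ η P μₖ hₖ(q)`. -/
def phi (q : Plane) (mu : Fin K → ℝ) : ℝ := ∑ k, N.η * N.P * mu k * N.gain k q

/-- The set of global maximizers of `φ(·, μ)` over the plane. -/
def maximizers (mu : Fin K → ℝ) : Set Plane := {q | ∀ q', N.phi q' mu ≤ N.phi q mu}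

/-- The uplink power `Q^(λ,μ) = (λ / (T μ ln 2) - H² / γ)⁺` (used for `μ > 0` only). -/
def power (l m : ℝ) : ℝ := max (l / (N.T * m * Real.log 2) - N.H ^ 2 / N.snr) 0

/-- Feasibility for the linear program that determines the hovering durations `τ ω` at `qbar ω` and
`ς k` above user `k`. -/
structure LPFeasible (lam mu : Fin K → ℝ) {Ω : ℕ} (qbar : Fin Ω → Plane)
    (ς : Fin K → ℝ) (τ : Fin Ω → ℝ) (R : ℝ) : Prop where
  ς_nonneg : ∀ k, 0 ≤ ς k
  τ_nonneg : ∀ ω, 0 ≤ τ ω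
  throughput_ge : ∀ k, R ≤ ς k / N.T *
    Real.logb 2 (1 + N.power (lam k) (mu k) * N.gain k (N.w k) / N.σsq)
  energy_le : ∀ k, ς k * N.power (lam k) (mu k) ≤ ∑ ω, τ ω * (N.η * N.P * N.gain k (qbar ω))
  total_time : ∑ k, ς k + ∑ ω, τ ω = N.T

/-- `(ς, τ, R)` is an optimal solution of the linear program. -/
def IsLPOptimal (lam mu : Fin K → ℝ) {Ω : ℕ} (qbar : Fin Ω → Plane)
    (ς : Fin K → ℝ) (τ : Fin Ω → ℝ) (R : ℝ) : Prop :=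
  N.LPFeasible lam mu qbar ς τ R ∧
    ∀ ς' τ' R', N.LPFeasible lam mu qbar ς' τ' R' → R' ≤ R

/-- The sub-period for downlink power transfer at the `ω`-th location. -/
def downlinkPeriod {Ω : ℕ} (τ : Fin Ω → ℝ) (ω : Fin Ω) : Set ℝ :=
  Set.Ioc (∑ j ∈ Finset.Iio ω, τ j) (∑ j ∈ Finset.Iic ω, τ j)

/-- The sub-period for the uplink of user `k`. -/
def uplinkPeriod {Ω : ℕ} (ς : Fin K → ℝ) (τ : Fin Ω → ℝ) (k : Fin K) : Set ℝ :=
  Set.Ioc (∑ ω, τ ω + ∑ j ∈ Finset.Iio k, ς j) (∑ ω, τ ω + ∑ j ∈ Finset.Iic k, ς j)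

/-- `s` is the multi-location-hovering schedule with hovering durations `τ` and `ς`. -/
structure IsHovering (lam mu : Fin K → ℝ) {Ω : ℕ} (qbar : Fin Ω → Plane)
    (ς : Fin K → ℝ) (τ : Fin Ω → ℝ) (s : Schedule K) : Prop where
  downlink : ∀ ω, ∀ t ∈ downlinkPeriod τ ω,
    s.q t = qbar ω ∧ s.ρ 0 t = 1 ∧ ∀ k : Fin K, s.ρ k.succ t = 0 ∧ s.Q k t = 0
  uplink : ∀ k, ∀ t ∈ uplinkPeriod ς τ k,
    s.q t = N.w k ∧ s.ρ k.succ t = 1 ∧ s.Q k t = N.power (lam k) (mu k) ∧ s.ρ 0 t = 0 ∧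
      ∀ j : Fin K, j ≠ k → s.ρ j.succ t = 0 ∧ s.Q j t = 0

end Network

end UAV

end

/-! The proof is Lagrangian duality without a convexity assumption on the schedules. When the `lam
k` sum to one, the Lagrangian is the integral over time of a density. At each instant exactly one
mode is active, so the density is `phi` at the current location or the `uplinkValue` of one user,
whose gain is largest straight above that user. Hence the dual function is `T` times the supremum
`V` of `phi` and all uplink densities: `dual_le` bounds it above, and constant schedules bound it
below.

These pieces are linear in the multipliers. At a dual optimum every `mu k` is positive (`mu_pos`),
so the suprema are attained: `phi` on `maximizers mu`, the uplink density at `power`. Hovering at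
these points with these powers gives the columns of the linear program. If no time sharing among the
columns reached `T * V`, a separating functional would be a direction in the multipliers that lowers
every active piece, contradicting dual optimality (`exists_dual_lt`, `exists_lpFeasible`). Thus the
linear program attains the dual value, weak duality bounds every feasible schedule by it, and a
hovering schedule realizes any point of the linear program.

That `phi` has finitely many maximizers is an algebraic fact: with the conjugate of `z` treated as
an independent variable, a critical point at a given level becomes a double root, and a resultant
allows only finitely many. -/

open MeasureTheory

noncomputable section

namespace UAV

/-! ### Finiteness of critical points by resultants -/

section Finiteness

open Polynomial

/-- If a bivariate polynomial is separable in one variable at one value of the other, then it has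
a multiple root only at finitely many values of the other. -/
lemma finite_multipleRoot_parameters {F : Type*} [Field F] [CharZero F] (G : F[X][X]) (s₀ : F)
    (hdeg : G.natDegree ≤ (G.map (evalRingHom s₀)).natDegree)
    (hpos : 0 < (G.map (evalRingHom s₀)).natDegree)
    (hsep : (G.map (evalRingHom s₀)).Separable) :
    {s : F | ∃ z, (G.map (evalRingHom s)).eval z = 0 ∧
      (derivative (G.map (evalRingHom s))).eval z = 0}.Finite := by
  classical
  set n := (G.map (evalRingHom s₀)).natDegree with hn
  have hder : (derivative G).natDegree ≤ n - 1 :=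
    (natDegree_derivative_le G).trans (Nat.sub_le_sub_right hdeg 1)
  -- The resultant in the outer variable is a combination of `G` and its derivative, so it vanishes
  -- at every parameter with a common root.
  obtain ⟨p, q, -, -, hpq⟩ :=
    exists_mul_add_mul_eq_C_resultant G (derivative G) hdeg hder (Or.inl hpos.ne')
  set r := G.resultant (derivative G) n (n - 1) with hr
  -- With the formal degrees fixed at `n` and `n - 1`, the resultant commutes with specialization at
  -- `s₀`, where separability makes it nonzero.
  have hr0 : r.eval s₀ ≠ 0 := by
    have h1 := resultant_map_map G (derivative G) n (n - 1) (evalRingHom s₀)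
    rw [← hr, coe_evalRingHom] at h1
    rw [← h1, ← derivative_map]
    have h2 := resultant_ne_zero _ _ hsep
    rwa [natDegree_derivative, ← hn] at h2
  have hrne : r ≠ 0 := by
    rintro h
    simp [h] at hr0
  refine (r.roots.toFinset.finite_toSet).subset ?_
  rintro s ⟨z, h1, h2⟩
  have h3 := congrArg (fun P : F[X][X] => (P.map (evalRingHom s)).eval z) hpq
  simp only [Polynomial.map_add, Polynomial.map_mul, eval_add, eval_mul, ← derivative_map, h1, h2,
    zero_mul, add_zero, Polynomial.map_C, eval_C, coe_evalRingHom] at h3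
  simp [hrne, IsRoot, ← h3]

/-- A potential of finitely many centres has finitely many critical points at a nonzero level. -/
lemma finite_critical_points (S : Finset ℂ) (hS : S.Nonempty) (c : ℂ → ℝ) {H M : ℝ} (hH : 0 < H)
    (hM : M ≠ 0) :
    {z : ℂ | ∑ v ∈ S, c v / (‖z - v‖ ^ 2 + H ^ 2) = M ∧
      ∑ v ∈ S, (c v / (‖z - v‖ ^ 2 + H ^ 2) ^ 2 : ℝ) * (z - v) = 0}.Finite := by
  classical
  -- The outer variable is `z`, the inner one `s` stands for `1 / star z`. At such a pair `E v`
  -- equals `s * (‖z - v‖ ^ 2 + H ^ 2)`, and `G` is the equation "potential = `M`" with denominators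
  -- cleared.
  set E : ℂ → ℂ[X][X] := fun v =>
    (X - C (C v)) * C (1 - C (star v) * X) + C (C ((H : ℂ) ^ 2) * X) with hE
  set G : ℂ[X][X] := C (C (M : ℂ)) * ∏ v ∈ S, E v
    - ∑ v ∈ S, C (C (c v : ℂ) * X) * ∏ j ∈ S.erase v, E j with hG
  have hMc : (M : ℂ) ≠ 0 := by exact_mod_cast hM
  have hEdeg : ∀ v, (E v).natDegree ≤ 1 := by
    intro v
    simp only [hE]
    compute_degree
  have hprod : ∀ t : Finset ℂ, (∏ v ∈ t, E v).natDegree ≤ t.card := by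
    intro t
    refine (natDegree_prod_le _ _).trans ?_
    refine (Finset.sum_le_sum fun v _ => hEdeg v).trans ?_
    simp
  have hGdeg : G.natDegree ≤ S.card := by
    refine (natDegree_sub_le _ _).trans (max_le ?_ ?_)
    · exact (natDegree_C_mul_le _ _).trans (hprod S)
    · refine natDegree_sum_le_of_forall_le _ _ fun v _ => ?_
      exact (natDegree_C_mul_le _ _).trans
        ((hprod _).trans (Finset.card_le_card (Finset.erase_subset _ _)))
  have hEmap : ∀ s v, (E v).map (evalRingHom s) =
      (X - C v) * C (1 - star v * s) + C ((H : ℂ) ^ 2 * s) := by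
    intro s v
    simp [hE]
  have hGmap : ∀ s, G.map (evalRingHom s) = C (M : ℂ) * ∏ v ∈ S, (E v).map (evalRingHom s)
      - ∑ v ∈ S, C (c v * s) * ∏ j ∈ S.erase v, (E j).map (evalRingHom s) := by
    intro s
    simp [hG, Polynomial.map_sum, Polynomial.map_prod]
  -- At `s = 0`, which corresponds to `z` at infinity, the potential drops out. What remains is
  -- separable because the centres are distinct.
  have hG0 : G.map (evalRingHom 0) = C (M : ℂ) * ∏ v ∈ S, (X - C v) := by
    rw [hGmap]
    simp [hEmap]
  have hG0deg : (G.map (evalRingHom 0)).natDegree = S.card := by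
    rw [hG0, natDegree_C_mul hMc, natDegree_prod_of_monic _ _ fun v _ => monic_X_sub_C v]
    simp
  have hfin := finite_multipleRoot_parameters G 0 (hG0deg ▸ hGdeg)
    (hG0deg ▸ hS.card_pos) (by
      rw [hG0]
      refine ((separable_prod_X_sub_C_iff' (f := fun v : ℂ => v)).2 fun x _ y _ h => h).unit_mul ?_
      exact isUnit_C.2 hMc.isUnit)
  -- The point `z = 0` has no parameter `1 / star z` and is added by hand.
  refine ((hfin.image fun s : ℂ => star s⁻¹).union (Set.finite_singleton 0)).subset ?_
  rintro z ⟨h1, h2⟩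
  by_cases hz : z = 0
  · exact Or.inr hz
  refine Or.inl ⟨(star z)⁻¹, ⟨z, ?_⟩, by simp⟩
  set s := (star z)⁻¹ with hs
  have hsz : s * star z = 1 := inv_mul_cancel₀ (by simpa using hz)
  have hs0 : s ≠ 0 := left_ne_zero_of_mul_eq_one hsz
  have hD : ∀ v, (‖z - v‖ ^ 2 + H ^ 2 : ℝ) ≠ 0 := fun v => by positivity
  have hDc : ∀ v, ((‖z - v‖ ^ 2 + H ^ 2 : ℝ) : ℂ) ≠ 0 := fun v => by exact_mod_cast hD v
  have hEz : ∀ v, ((E v).map (evalRingHom s)).eval z = s * (‖z - v‖ ^ 2 + H ^ 2 : ℝ) := by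
    intro v
    have : ((‖z - v‖ : ℂ)) ^ 2 = (z - v) * (star z - star v) := by
      rw [← star_sub]
      exact (Complex.mul_conj' (z - v)).symm
    rw [hEmap]
    push_cast
    rw [this]
    simp only [eval_add, eval_mul, eval_sub, eval_X, eval_C]
    linear_combination (v - z) * hsz
  have hEz0 : ∀ v, ((E v).map (evalRingHom s)).eval z ≠ 0 := fun v => by
    rw [hEz]; exact mul_ne_zero hs0 (hDc v)
  -- Away from the zeros of the factors the polynomial is a product with the shifted potential.
  have hfac : ∀ y, (∀ v ∈ S, ((E v).map (evalRingHom s)).eval y ≠ 0) →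
      (G.map (evalRingHom s)).eval y = (∏ v ∈ S, (E v).map (evalRingHom s)).eval y *
        (M - ∑ v ∈ S, c v * s / ((E v).map (evalRingHom s)).eval y) := by
    intro y hy
    rw [hGmap, mul_sub, Finset.mul_sum]
    simp only [eval_sub, eval_mul, eval_C, eval_finsetSum, eval_prod]
    congr 1
    · ring
    · refine Finset.sum_congr rfl fun v hv => ?_
      rw [← Finset.mul_prod_erase S _ hv]
      field_simp [hy v hv]
  have hval : (M : ℂ) - ∑ v ∈ S, c v * s / ((E v).map (evalRingHom s)).eval z = 0 := by
    rw [← h1]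
    push_cast
    rw [sub_eq_zero]
    refine Finset.sum_congr rfl fun v _ => ?_
    rw [hEz]
    have := hDc v
    push_cast at this ⊢
    field_simp
  refine ⟨by rw [hfac z fun v _ => hEz0 v, hval, mul_zero], ?_⟩
  have hev : (fun y => (G.map (evalRingHom s)).eval y) =ᶠ[nhds z]
      fun y => (∏ v ∈ S, (E v).map (evalRingHom s)).eval y *
        (M - ∑ v ∈ S, c v * s / ((E v).map (evalRingHom s)).eval y) := by
    have : ∀ᶠ y in nhds z, ∀ v ∈ S, ((E v).map (evalRingHom s)).eval y ≠ 0 := by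
      rw [Filter.eventually_all_finset]
      intro v _
      exact ((E v).map (evalRingHom s)).continuous.continuousAt.eventually_ne (hEz0 v)
    exact this.mono hfac
  have hE' : ∀ v, HasDerivAt (fun y => ((E v).map (evalRingHom s)).eval y)
      (1 - star v * s) z := by
    intro v
    refine (((E v).map (evalRingHom s)).hasDerivAt z).congr_deriv ?_
    rw [hEmap]
    simp [derivative_pow]
  have hsum : HasDerivAt (fun y => (M : ℂ) - ∑ v ∈ S, c v * s / ((E v).map (evalRingHom s)).eval y)
      0 z := by
    have h3 := HasDerivAt.fun_sum (u := S) fun v (_ : v ∈ S) =>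
      ((hE' v).inv (hEz0 v)).const_mul ((c v : ℂ) * s)
    -- The derivative in `z` with `s` held fixed is the conjugate of the critical point equation.
    have h5 : (starRingEnd ℂ) (∑ v ∈ S,
        ((c v / (‖z - v‖ ^ 2 + H ^ 2) ^ 2 : ℝ) : ℂ) * (z - v)) = 0 := by rw [h2]; simp
    refine (h3.const_sub (M : ℂ)).congr_deriv ?_
    rw [← h5, map_sum, ← Finset.sum_neg_distrib]
    refine Finset.sum_congr rfl fun v _ => ?_
    have h8 : 1 - star v * s = s * (star z - star v) := by linear_combination -hsz
    rw [hEz, h8, map_mul, Complex.conj_ofReal, map_sub, starRingEnd_apply, starRingEnd_apply]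
    have := hDc v
    rw [Complex.ofReal_div, Complex.ofReal_pow]
    field_simp
  have h6 := ((∏ v ∈ S, (E v).map (evalRingHom s)).hasDerivAt z).mul hsum
  rw [hval] at h6
  have h7 := (h6.congr_of_eventuallyEq hev).unique ((G.map (evalRingHom s)).hasDerivAt z)
  simpa using h7.symm

end Finiteness

/-- The derivative at `z` in the direction of the left-hand vector `u` itself is `-2 * ‖u‖ ^ 2`,
which must vanish at a maximum. -/
lemma sum_smul_sub_eq_zero_of_isMax {E : Type*} [NormedAddCommGroup E] [InnerProductSpace ℝ E]
    {ι : Type*} (S : Finset ι) (c : ι → ℝ) (p : ι → E) {H : ℝ} (hH : 0 < H) {z : E}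
    (hz : ∀ y, ∑ i ∈ S, c i / (‖y - p i‖ ^ 2 + H ^ 2) ≤
      ∑ i ∈ S, c i / (‖z - p i‖ ^ 2 + H ^ 2)) :
    ∑ i ∈ S, (c i / (‖z - p i‖ ^ 2 + H ^ 2) ^ 2) • (z - p i) = 0 := by
  set u := ∑ i ∈ S, (c i / (‖z - p i‖ ^ 2 + H ^ 2) ^ 2) • (z - p i) with hu
  have hline : ∀ i, HasDerivAt (fun t : ℝ => z + t • u - p i) u 0 := fun i => by
    simpa using (((hasDerivAt_id (0 : ℝ)).smul_const u).const_add z).sub_const (p i)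
  have hterm : ∀ i, HasDerivAt (fun t : ℝ => c i / (‖z + t • u - p i‖ ^ 2 + H ^ 2))
      (-2 * inner ℝ ((c i / (‖z - p i‖ ^ 2 + H ^ 2) ^ 2) • (z - p i)) u) 0 := by
    intro i
    have h1 := ((hline i).norm_sq.add_const (H ^ 2)).inv (by positivity)
    refine (h1.const_mul (c i)).congr_deriv ?_
    simp only [zero_smul, add_zero, real_inner_smul_left]
    ring
  have hsum := HasDerivAt.fun_sum (u := S) fun i _ => hterm i
  have hmax : IsLocalMax (fun t : ℝ => ∑ i ∈ S, c i / (‖z + t • u - p i‖ ^ 2 + H ^ 2)) 0 :=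
    Filter.Eventually.of_forall fun t => by simpa using hz (z + t • u)
  have h0 := hmax.hasDerivAt_eq_zero hsum
  rw [← Finset.mul_sum, ← sum_inner, ← hu] at h0
  simpa using h0

/-! ### Gains, `phi` and the optimal uplink power -/

namespace Network

variable {K : ℕ} (N : Network K)

lemma gain_pos (k : Fin K) (q : Plane) : 0 < N.gain k q := by
  have := N.H_pos
  have := N.β₀_pos
  unfold gain
  positivity

lemma gain_le (k : Fin K) (q : Plane) : N.gain k q ≤ N.β₀ / N.H ^ 2 := by
  have := N.H_pos
  have := N.β₀_pos
  unfold gain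
  gcongr
  nlinarith [sq_nonneg ‖q - N.w k‖]

lemma gain_self (k : Fin K) : N.gain k (N.w k) = N.β₀ / N.H ^ 2 := by
  simp [gain]

lemma continuous_gain (k : Fin K) : Continuous (N.gain k) := by
  unfold gain
  refine continuous_const.div (by fun_prop) fun q => ?_
  have := N.H_pos
  positivity

lemma continuous_phi (mu : Fin K → ℝ) : Continuous fun q => N.phi q mu := by
  unfold phi
  exact continuous_finsetSum _ fun k _ => continuous_const.mul (N.continuous_gain k)

lemma phi_pos (hK : 1 ≤ K) {mu : Fin K → ℝ} (hmu : ∀ k, 0 < mu k) (q : Plane) :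
    0 < N.phi q mu := by
  have : Nonempty (Fin K) := ⟨⟨0, hK⟩⟩
  have := N.η_pos
  have := N.P_pos
  unfold phi
  refine Finset.sum_pos (fun k _ => ?_) Finset.univ_nonempty
  have := hmu k
  have := N.gain_pos k q
  positivity

lemma tendsto_phi (mu : Fin K → ℝ) :
    Filter.Tendsto (fun q => N.phi q mu) (Filter.cocompact Plane) (nhds 0) := by
  have h : ∀ k, Filter.Tendsto (N.gain k) (Filter.cocompact Plane) (nhds 0) := by
    intro k
    have h1 : Filter.Tendsto (fun q : Plane => ‖q - N.w k‖) (Filter.cocompact Plane)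
        Filter.atTop := by
      simpa [dist_eq_norm] using tendsto_dist_right_cocompact_atTop (N.w k)
    refine Filter.Tendsto.const_div_atTop ?_ _
    exact Filter.tendsto_atTop_add_const_right _ _
      ((Filter.tendsto_pow_atTop two_ne_zero).comp h1)
  have h2 := tendsto_finsetSum Finset.univ fun k (_ : k ∈ Finset.univ) =>
    (h k).const_mul (N.η * N.P * mu k)
  simpa [phi] using h2

/-- `phi` is continuous, positive and tends to zero at infinity. Closed sets other than the plane
are needed in `exists_dual_lt`. -/
lemma exists_isMaxOn_phi (hK : 1 ≤ K) {mu : Fin K → ℝ} (hmu : ∀ k, 0 < mu k) {F : Set Plane}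
    (hF : IsClosed F) (hne : F.Nonempty) : ∃ q ∈ F, ∀ q' ∈ F, N.phi q' mu ≤ N.phi q mu := by
  obtain ⟨q₀, hq₀⟩ := hne
  refine (N.continuous_phi mu).continuousOn.exists_isMaxOn' hF hq₀ ?_
  refine Filter.Eventually.filter_mono inf_le_left ?_
  exact ((N.tendsto_phi mu).eventually_lt_const (N.phi_pos hK hmu q₀)).mono fun _ h => h.le

lemma maximizers_nonempty (hK : 1 ≤ K) {mu : Fin K → ℝ} (hmu : ∀ k, 0 < mu k) :
    (N.maximizers mu).Nonempty := by
  obtain ⟨q, -, hq⟩ := N.exists_isMaxOn_phi hK hmu isClosed_univ Set.univ_nonempty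
  exact ⟨q, fun q' => hq q' trivial⟩

/-- All maximizers are critical points at one positive level. Users at the same location are merged
into one centre with added weights, so that the centres are distinct. -/
lemma maximizers_finite (hK : 1 ≤ K) {mu : Fin K → ℝ} (hmu : ∀ k, 0 < mu k) :
    (N.maximizers mu).Finite := by
  classical
  obtain ⟨q₀, hq₀⟩ := N.maximizers_nonempty hK hmu
  let e : Plane ≃ₗᵢ[ℝ] ℂ := Complex.orthonormalBasisOneI.repr.symm
  let S : Finset ℂ := Finset.univ.image fun k => e (N.w k)
  let c : ℂ → ℝ := fun v => ∑ k with e (N.w k) = v, N.η * N.P * mu k * N.β₀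
  have hphi : ∀ q, N.phi q mu = ∑ v ∈ S, c v / (‖e q - v‖ ^ 2 + N.H ^ 2) := by
    intro q
    have h1 := Finset.sum_fiberwise_of_maps_to (s := Finset.univ) (t := S)
      (g := fun k => e (N.w k)) (fun k hk => Finset.mem_image_of_mem _ hk)
      (fun k => N.η * N.P * mu k * N.gain k q)
    rw [phi, ← h1]
    refine Finset.sum_congr rfl fun v _ => ?_
    rw [Finset.sum_div]
    refine Finset.sum_congr rfl fun k hk => ?_
    rw [← (Finset.mem_filter.1 hk).2, ← map_sub, e.norm_map, gain]
    ring
  have hS : S.Nonempty := ⟨e (N.w ⟨0, hK⟩), Finset.mem_image_of_mem _ (Finset.mem_univ _)⟩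
  have hfin := finite_critical_points S hS c N.H_pos (N.phi_pos hK hmu q₀).ne'
  refine (hfin.preimage e.injective.injOn).subset fun q hq => ⟨?_, ?_⟩
  · rw [← hphi]
    exact le_antisymm (hq₀ q) (hq q₀)
  · have h2 := sum_smul_sub_eq_zero_of_isMax S c id N.H_pos (z := e q) fun y => by
      have := hq (e.symm y)
      rw [hphi, hphi] at this
      simpa using this
    simpa using h2

/-- Lagrangian density of the uplink of a user when the UAV hovers above that user. -/
def uplinkValue (l m Q : ℝ) : ℝ :=
  l / N.T * Real.logb 2 (1 + Q * (N.β₀ / N.H ^ 2) / N.σsq) - m * Q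

lemma power_nonneg (l m : ℝ) : 0 ≤ N.power l m := le_max_right _ _

/-- The density is concave in `Q`: the logarithm lies below its tangent at `power`, where the slope
of the density is zero, or nonpositive if the power is clipped at zero. -/
lemma uplinkValue_le_power {l m Q : ℝ} (hl : 0 ≤ l) (hm : 0 < m) (hQ : 0 ≤ Q) :
    N.uplinkValue l m Q ≤ N.uplinkValue l m (N.power l m) := by
  have hT := N.T_pos
  have hH := N.H_pos
  have hβ := N.β₀_pos
  have hσ := N.σsq_pos
  have hlog : 0 < Real.log 2 := Real.log_pos one_lt_two
  set Qb := N.power l m with hQb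
  have hQb0 : 0 ≤ Qb := N.power_nonneg l m
  set c := N.β₀ / N.H ^ 2 / N.σsq with hc
  have hc0 : 0 < c := by positivity
  have hinv : N.H ^ 2 / N.snr = 1 / c := by
    rw [hc, snr]
    field_simp
  have hpos : 0 < 1 + c * Qb := by positivity
  have hconc : Real.log (1 + c * Q) - Real.log (1 + c * Qb) ≤ c * (Q - Qb) / (1 + c * Qb) := by
    rw [← Real.log_div (by positivity) hpos.ne']
    refine (Real.log_le_sub_one_of_pos (by positivity)).trans_eq ?_
    field_simp
    ring
  -- The first-order optimality condition.
  have hkkt : l / (N.T * Real.log 2) * (c * (Q - Qb) / (1 + c * Qb)) ≤ m * (Q - Qb) := by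
    set a := l / (N.T * Real.log 2) with ha
    have ha0 : 0 ≤ a := by positivity
    have hQb' : Qb = max (a / m - 1 / c) 0 := by
      rw [hQb, power, hinv, ha]
      congr 2
      field_simp
    rw [mul_div_assoc', div_le_iff₀ hpos]
    rcases le_total (a / m - 1 / c) 0 with h | h
    · rw [max_eq_right h] at hQb'
      have : a * c ≤ m := by
        rw [sub_nonpos, div_le_div_iff₀ hm hc0] at h
        linarith
      rw [hQb']
      nlinarith
    · rw [max_eq_left h] at hQb'
      have : m * (1 + c * Qb) = a * c := by
        rw [hQb']
        field_simp
        ring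
      nlinarith
  have hrw : ∀ x, N.uplinkValue l m x
      = l / (N.T * Real.log 2) * Real.log (1 + c * x) - m * x := by
    intro x
    rw [uplinkValue, Real.logb, hc]
    field_simp
  rw [hrw, hrw]
  have h3 : l / (N.T * Real.log 2) * (Real.log (1 + c * Q) - Real.log (1 + c * Qb)) ≤
      l / (N.T * Real.log 2) * (c * (Q - Qb) / (1 + c * Qb)) :=
    mul_le_mul_of_nonneg_left hconc (by positivity)
  linarith

lemma tendsto_power {α : Type*} {f : Filter α} {u v : α → ℝ} {l m : ℝ} (hm : 0 < m)
    (hu : Filter.Tendsto u f (nhds l)) (hv : Filter.Tendsto v f (nhds m)) :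
    Filter.Tendsto (fun x => N.power (u x) (v x)) f (nhds (N.power l m)) := by
  have hT := N.T_pos
  have hlog : 0 < Real.log 2 := Real.log_pos one_lt_two
  unfold power
  refine Filter.Tendsto.max ?_ tendsto_const_nhds
  exact (hu.div ((hv.const_mul N.T).mul_const _) (by positivity)).sub_const _

/-! ### Bounds on the Lagrangian and the dual function -/

instance : IsFiniteMeasure N.periodMeasure := by
  unfold periodMeasure
  infer_instance

lemma periodMeasure_real_univ : N.periodMeasure.real Set.univ = N.T := by
  simp [periodMeasure, N.T_pos.le]

lemma ae_mem_period : ∀ᵐ t ∂N.periodMeasure, t ∈ Set.Ioc 0 N.T :=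
  ae_restrict_mem measurableSet_Ioc

variable {N}

namespace Admissible

variable {s : Schedule K}

lemma mode_nonneg (hs : N.Admissible s)
    (i : Fin (K + 1)) {t : ℝ} (ht : t ∈ Set.Ioc 0 N.T) : 0 ≤ s.ρ i t := by
  rcases hs.binary i t ht with h | h <;> simp [h]

lemma mode_le_one (hs : N.Admissible s)
    (i : Fin (K + 1)) {t : ℝ} (ht : t ∈ Set.Ioc 0 N.T) : s.ρ i t ≤ 1 := by
  rcases hs.binary i t ht with h | h <;> simp [h]

lemma aemeasurable_gain (hs : N.Admissible s) (k : Fin K) :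
    AEMeasurable (fun t => N.gain k (s.q t)) N.periodMeasure :=
  (N.continuous_gain k).measurable.comp_aemeasurable hs.measurable_q

lemma integrable_harvest (hs : N.Admissible s) (k : Fin K) :
    Integrable (fun t => N.harvest k (s.ρ 0 t) (s.q t)) N.periodMeasure := by
  have hη := N.η_pos
  have hP := N.P_pos
  refine Integrable.of_bound (C := N.η * N.P * 1 * (N.β₀ / N.H ^ 2)) ?_ ?_
  · unfold harvest
    exact (((hs.measurable_ρ 0).const_mul _).mul (hs.aemeasurable_gain k)).aestronglyMeasurable
  · filter_upwards [N.ae_mem_period] with t ht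
    have h0 := hs.mode_nonneg 0 ht
    have h1 := hs.mode_le_one 0 ht
    have h2 := N.gain_pos k (s.q t)
    have h3 := N.gain_le k (s.q t)
    rw [harvest, Real.norm_of_nonneg (by positivity)]
    gcongr

lemma rate_nonneg (hs : N.Admissible s) (k : Fin K) {t : ℝ} (ht : t ∈ Set.Ioc 0 N.T) :
    0 ≤ N.rate k (s.ρ k.succ t) (s.q t) (s.Q k t) := by
  have hQ := hs.power_nonneg k t ht
  have h2 := N.gain_pos k (s.q t)
  have := N.σsq_pos
  refine mul_nonneg (hs.mode_nonneg _ ht) (Real.logb_nonneg one_lt_two ?_)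
  have : 0 ≤ s.Q k t * N.gain k (s.q t) / N.σsq := by positivity
  linarith

/-- Since `log (1 + x) ≤ x`, the rate is dominated by a multiple of the consumed power. -/
lemma integrable_rate (hs : N.Admissible s) (k : Fin K) :
    Integrable (fun t => N.rate k (s.ρ k.succ t) (s.q t) (s.Q k t)) N.periodMeasure := by
  have hlog : 0 < Real.log 2 := Real.log_pos one_lt_two
  have hσ := N.σsq_pos
  refine ((hs.integrable k).const_mul (N.β₀ / N.H ^ 2 / N.σsq / Real.log 2)).mono' ?_ ?_
  · refine AEMeasurable.aestronglyMeasurable ?_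
    unfold rate Real.logb
    exact (hs.measurable_ρ _).mul ((Real.measurable_log.comp_aemeasurable
      ((((hs.measurable_Q k).mul (hs.aemeasurable_gain k)).div_const _).const_add 1)).div_const _)
  · filter_upwards [N.ae_mem_period] with t ht
    rw [Real.norm_of_nonneg (hs.rate_nonneg k ht)]
    have hQ := hs.power_nonneg k t ht
    have h0 := hs.mode_nonneg k.succ ht
    have h2 := N.gain_pos k (s.q t)
    have h3 := N.gain_le k (s.q t)
    have h4 : Real.log (1 + s.Q k t * N.gain k (s.q t) / N.σsq) ≤
        s.Q k t * (N.β₀ / N.H ^ 2) / N.σsq := by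
      refine (Real.log_le_sub_one_of_pos (by positivity)).trans ?_
      rw [add_sub_cancel_left]
      gcongr
    calc N.rate k (s.ρ k.succ t) (s.q t) (s.Q k t)
        ≤ s.ρ k.succ t * (s.Q k t * (N.β₀ / N.H ^ 2) / N.σsq / Real.log 2) := by
          unfold rate Real.logb
          gcongr
      _ = _ := by ring

/-- The integrand is a combination, with the mode indicators as weights, of `phi` and the uplink
densities; the weights are nonnegative and sum to one. Replacing the gain by its largest value
reduces each uplink density to `uplinkValue`. -/
lemma lagrangian_le (hs : N.Admissible s) {lam mu : Fin K → ℝ} (hd : DualFeasible lam mu) {V : ℝ}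
    (hphi : ∀ q, N.phi q mu ≤ V)
    (hup : ∀ k, ∀ Q, 0 ≤ Q → N.uplinkValue (lam k) (mu k) Q ≤ V) (R : ℝ) :
    N.lagrangian s R lam mu ≤ N.T * V := by
  have hT := N.T_pos
  have hσ := N.σsq_pos
  have hrate := hs.integrable_rate
  have hharv := hs.integrable_harvest
  have hcons := hs.integrable
  have heq : N.lagrangian s R lam mu = ∫ t, (∑ k, (lam k * (1 / N.T)) *
      N.rate k (s.ρ k.succ t) (s.q t) (s.Q k t)
      + ∑ k, mu k * (N.harvest k (s.ρ 0 t) (s.q t) - s.ρ k.succ t * s.Q k t))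
        ∂N.periodMeasure := by
    rw [integral_add, integral_finsetSum, integral_finsetSum]
    · simp_rw [integral_const_mul]
      rw [lagrangian, hd.1, sub_self, zero_mul, zero_add]
      congr 1
      · simp [throughput, mul_assoc]
      · refine Finset.sum_congr rfl fun k _ => ?_
        rw [integral_sub (hharv k) (hcons k)]
        rfl
    · exact fun k _ => ((hharv k).sub (hcons k)).const_mul _
    · exact fun k _ => (hrate k).const_mul _
    · exact integrable_finsetSum _ fun k _ => (hrate k).const_mul _
    · exact integrable_finsetSum _ fun k _ => ((hharv k).sub (hcons k)).const_mul _
  have hconst : N.T * V = ∫ _, V ∂N.periodMeasure := by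
    rw [integral_const, N.periodMeasure_real_univ, smul_eq_mul]
  rw [heq, hconst]
  refine integral_mono_ae ?_ (integrable_const _) ?_
  · exact (integrable_finsetSum _ fun k _ => (hrate k).const_mul _).add
      (integrable_finsetSum _ fun k _ => ((hharv k).sub (hcons k)).const_mul _)
  filter_upwards [N.ae_mem_period] with t ht
  have hsum := hs.sum_eq_one t ht
  rw [Fin.sum_univ_succ] at hsum
  have hterm : ∀ k : Fin K, lam k * (1 / N.T) * Real.logb 2
      (1 + s.Q k t * N.gain k (s.q t) / N.σsq) - mu k * s.Q k t ≤ V := by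
    intro k
    have hQ := hs.power_nonneg k t ht
    have h2 := N.gain_pos k (s.q t)
    have h3 := N.gain_le k (s.q t)
    have hl := hd.2.1 k
    refine le_trans ?_ (hup k _ hQ)
    rw [uplinkValue, mul_one_div]
    have h5 : Real.logb 2 (1 + s.Q k t * N.gain k (s.q t) / N.σsq) ≤
        Real.logb 2 (1 + s.Q k t * (N.β₀ / N.H ^ 2) / N.σsq) := by
      refine Real.logb_le_logb_of_le one_lt_two (by positivity) ?_
      gcongr
    gcongr
  calc _ = s.ρ 0 t * N.phi (s.q t) mu + ∑ k : Fin K, s.ρ k.succ t * (lam k * (1 / N.T) *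
        Real.logb 2 (1 + s.Q k t * N.gain k (s.q t) / N.σsq) - mu k * s.Q k t) := by
        rw [phi, Finset.mul_sum, ← Finset.sum_add_distrib, ← Finset.sum_add_distrib]
        refine Finset.sum_congr rfl fun k _ => ?_
        rw [rate, harvest]
        ring
    _ ≤ s.ρ 0 t * V + ∑ k : Fin K, s.ρ k.succ t * V := by
        gcongr with k
        · exact hs.mode_nonneg 0 ht
        · exact hphi _
        · exact hs.mode_nonneg _ ht
        · exact hterm k
    _ = V := by rw [← Finset.sum_mul, ← add_mul, hsum, one_mul]

end Admissible

lemma dual_le {lam mu : Fin K → ℝ} (hd : DualFeasible lam mu) {V : ℝ}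
    (hphi : ∀ q, N.phi q mu ≤ V)
    (hup : ∀ k, ∀ Q, 0 ≤ Q → N.uplinkValue (lam k) (mu k) Q ≤ V) :
    N.dual lam mu ≤ ((N.T * V : ℝ) : EReal) :=
  iSup_le fun _ => iSup_le fun hs => iSup_le fun R =>
    EReal.coe_le_coe_iff.2 (hs.lagrangian_le hd hphi hup R)

lemma lagrangian_le_dual {s : Schedule K} (hs : N.Admissible s) (R : ℝ) (lam mu : Fin K → ℝ) :
    ((N.lagrangian s R lam mu : ℝ) : EReal) ≤ N.dual lam mu :=
  le_iSup_of_le s (le_iSup_of_le hs (le_iSup_of_le R le_rfl))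

/-- The schedule that stays in mode `i` at location `q` with powers `Q`. -/
def constSchedule (i : Fin (K + 1)) (Q : Fin K → ℝ) (q : Plane) : Schedule K where
  ρ := fun j _ => if j = i then 1 else 0
  Q := fun k _ => Q k
  q := fun _ => q

variable (N) in
lemma admissible_constSchedule (i : Fin (K + 1)) {Q : Fin K → ℝ} (hQ : ∀ k, 0 ≤ Q k) (q : Plane) :
    N.Admissible (constSchedule i Q q) where
  binary j t _ := by
    simp only [constSchedule]
    split_ifs <;> simp
  sum_eq_one t _ := by simp [constSchedule]
  power_nonneg k _ _ := hQ k
  measurable_ρ _ := aemeasurable_const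
  measurable_Q _ := aemeasurable_const
  measurable_q := aemeasurable_const
  integrable k := integrable_const ((if k.succ = i then (1 : ℝ) else 0) * Q k)

variable (N) in
-- Power transfer from `q` during the whole period attains this value. With
-- `mul_uplinkValue_le_dual` it shows that the bound in `dual_le` is sharp.
lemma mul_phi_le_dual (lam mu : Fin K → ℝ) (q : Plane) :
    ((N.T * N.phi q mu : ℝ) : EReal) ≤ N.dual lam mu := by
  refine le_trans (le_of_eq ?_) (lagrangian_le_dual
    (N.admissible_constSchedule 0 (Q := 0) (fun _ => le_rfl) q) 0 lam mu)
  congr 1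
  simp only [lagrangian, throughput, harvestedEnergy, consumedEnergy, rate, harvest, constSchedule,
    integral_const, N.periodMeasure_real_univ, phi, Finset.mul_sum]
  simp [Fin.succ_ne_zero]
  refine Finset.sum_congr rfl fun k _ => by ring

variable (N) in
lemma mul_uplinkValue_le_dual (lam mu : Fin K → ℝ) (k : Fin K) {Q : ℝ} (hQ : 0 ≤ Q) :
    ((N.T * N.uplinkValue (lam k) (mu k) Q : ℝ) : EReal) ≤ N.dual lam mu := by
  have hT := N.T_pos
  refine le_trans (le_of_eq ?_) (lagrangian_le_dual
    (N.admissible_constSchedule k.succ (Q := fun _ => Q) (fun _ => hQ) (N.w k)) 0 lam mu)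
  congr 1
  simp only [lagrangian, throughput, harvestedEnergy, consumedEnergy, rate, harvest, constSchedule,
    integral_const, N.periodMeasure_real_univ, uplinkValue]
  simp [(Fin.succ_ne_zero k).symm, gain_self]
  field_simp
  ring

end Network

/-! ### Separation, dual attainment and strong duality -/

/-- Theorem of the alternative for a polytope and an orthant. -/
lemma exists_stdSimplex_or_exists_separating {ι κ : Type*} [Fintype ι] [Fintype κ]
    (p : κ → ι → ℝ) (b : ι → ℝ) :
    (∃ θ ∈ stdSimplex ℝ κ, ∀ i, b i ≤ ∑ j, θ j * p j i) ∨
      ∃ a : ι → ℝ, (∀ i, 0 ≤ a i) ∧ ∀ j, ∑ i, a i * p j i < ∑ i, a i * b i := by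
  classical
  set L : (κ → ℝ) →ₗ[ℝ] (ι → ℝ) := Fintype.linearCombination ℝ p with hL
  have hLapp : ∀ θ i, L θ i = ∑ j, θ j * p j i := fun θ i => by
    simp [hL, Fintype.linearCombination_apply]
  by_cases hdisj : Disjoint (L '' stdSimplex ℝ κ) (Set.Ici b)
  swap
  · left
    obtain ⟨_, ⟨θ, hθ, rfl⟩, hb⟩ := Set.not_disjoint_iff.1 hdisj
    exact ⟨θ, hθ, fun i => (hb i).trans_eq (hLapp θ i)⟩
  right
  obtain ⟨f, u, v, hu, huv, hv⟩ := geometric_hahn_banach_compact_closed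
    ((convex_stdSimplex ℝ κ).linear_image L)
    ((isCompact_stdSimplex ℝ κ).image L.continuous_of_finiteDimensional)
    (convex_Ici b) isClosed_Ici hdisj
  have hf : ∀ x : ι → ℝ, f x = ∑ i, f (Pi.single i 1) * x i := by
    intro x
    have h1 : x = ∑ i, x i • (Pi.single i 1 : ι → ℝ) := by
      ext j
      simp [Finset.sum_apply, Pi.single_apply]
    conv_lhs => rw [h1]
    simp only [map_sum, map_smul, smul_eq_mul, mul_comm]
  refine ⟨fun i => f (Pi.single i 1), fun i => ?_, fun j => ?_⟩
  · by_contra! hneg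
    -- A negative coefficient would make `f` unbounded below on the orthant; at this `n` the value
    -- of `f` has dropped to exactly `v`.
    set n : ℝ := (f b - v) / (-f (Pi.single i 1)) with hn
    have hb := hv b Set.self_mem_Ici
    have hn0 : 0 ≤ n := div_nonneg (by linarith) (by linarith)
    have h2 := hv (b + n • Pi.single i 1) (by
      refine Set.mem_Ici.2 (le_add_of_nonneg_right (smul_nonneg hn0 ?_))
      exact Pi.single_nonneg.2 zero_le_one)
    rw [map_add, map_smul, smul_eq_mul, hn, div_mul_eq_mul_div, div_neg,
      mul_div_cancel_right₀ _ hneg.ne] at h2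
    linarith
  · have h1 := hu (L (Pi.single j 1)) ⟨_, single_mem_stdSimplex ℝ j, rfl⟩
    have h2 := hv b Set.self_mem_Ici
    have h3 : L (Pi.single j 1) = p j := by
      ext i
      simp [hLapp, Pi.single_apply]
    rw [← hf, ← hf, ← h3]
    linarith

namespace Network

variable {K : ℕ} {N : Network K}

lemma le_phi_apply {mu : Fin K → ℝ} (hmu : ∀ k, 0 ≤ mu k) (k : Fin K) :
    N.η * N.P * mu k * (N.β₀ / N.H ^ 2) ≤ N.phi (N.w k) mu := by
  have hη := N.η_pos
  have hP := N.P_pos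
  rw [← N.gain_self k, phi]
  refine Finset.single_le_sum (f := fun j => N.η * N.P * mu j * N.gain j (N.w k))
    (fun j _ => ?_) (Finset.mem_univ k)
  have := hmu j
  have := N.gain_pos j (N.w k)
  positivity

lemma phi_le_sum {mu : Fin K → ℝ} (hmu : ∀ k, 0 ≤ mu k) (q : Plane) :
    N.phi q mu ≤ ∑ k, N.η * N.P * mu k * (N.β₀ / N.H ^ 2) := by
  have hη := N.η_pos
  have hP := N.P_pos
  refine Finset.sum_le_sum fun k _ => ?_
  have := hmu k
  have := N.gain_le k q
  gcongr

lemma phi_combination (q : Plane) (x y : ℝ) (mu b : Fin K → ℝ) :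
    N.phi q (fun k => x * mu k + y * b k) = x * N.phi q mu + y * N.phi q b := by
  simp only [phi, Finset.mul_sum, ← Finset.sum_add_distrib]
  exact Finset.sum_congr rfl fun k _ => by ring

lemma uplinkValue_combination (x y l m a b Q : ℝ) :
    N.uplinkValue (x * l + y * a) (x * m + y * b) Q =
      x * N.uplinkValue l m Q + y * N.uplinkValue a b Q := by
  simp only [uplinkValue]
  ring

/-- The finitely many suprema are attained, so some `V' < V` still bounds all pieces and the
inequality stays strict. -/
lemma dual_lt {lam mu : Fin K → ℝ} (hK : 1 ≤ K) (hd : DualFeasible lam mu) (hmu : ∀ k, 0 < mu k)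
    {V : ℝ} (hphi : ∀ q, N.phi q mu < V)
    (hup : ∀ k, N.uplinkValue (lam k) (mu k) (N.power (lam k) (mu k)) < V) :
    N.dual lam mu < ((N.T * V : ℝ) : EReal) := by
  obtain ⟨q, hq⟩ := N.maximizers_nonempty hK hmu
  have h1 : ∀ᶠ V' in nhdsWithin V (Set.Iio V), V' < V ∧ N.phi q mu ≤ V' ∧
      ∀ k, N.uplinkValue (lam k) (mu k) (N.power (lam k) (mu k)) ≤ V' := by
    refine Filter.Eventually.and eventually_mem_nhdsWithin (.and ?_ (Filter.eventually_all.2 fun k => ?_))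
    · exact nhdsWithin_le_nhds (eventually_ge_nhds (hphi q))
    · exact nhdsWithin_le_nhds (eventually_ge_nhds (hup k))
  obtain ⟨V', hV', h2, h3⟩ := h1.exists
  refine (dual_le hd (fun q' => (hq q').trans h2) fun k Q hQ =>
    (N.uplinkValue_le_power (hd.2.1 k) (hmu k) hQ).trans (h3 k)).trans_lt ?_
  exact EReal.coe_lt_coe_iff.2 (mul_lt_mul_of_pos_left hV' N.T_pos)

/-- The direction `a` may have any sum; the factor `1 - ε * ∑ k, a k` restores the normalization of
`lam`. A piece of value `V` then decreases exactly when its value at the direction is below `(∑ k, a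
k) * V`. -/
lemma dualFeasible_combination {lam mu a b : Fin K → ℝ} (hd : DualFeasible lam mu)
    (ha : ∀ k, 0 ≤ a k) (hb : ∀ k, 0 ≤ b k) {ε : ℝ} (hε : 0 ≤ ε) (h1 : 0 ≤ 1 - ε * ∑ k, a k) :
    DualFeasible (fun k => (1 - ε * ∑ k, a k) * lam k + ε * a k)
      (fun k => (1 - ε * ∑ k, a k) * mu k + ε * b k) := by
  refine ⟨?_, fun k => ?_, fun k => ?_⟩
  · rw [Finset.sum_add_distrib, ← Finset.mul_sum, ← Finset.mul_sum, hd.1]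
    ring
  · have := ha k
    have := hd.2.1 k
    positivity
  · have := hb k
    have := hd.2.2 k
    positivity

/-- A direction along which every active piece of the dual function decreases is a descent
direction. -/
lemma exists_dual_lt {lam mu : Fin K → ℝ} (hK : 1 ≤ K) (hd : DualFeasible lam mu)
    (hmu : ∀ k, 0 < mu k) {V : ℝ} (hV : 0 < V) (hphi : ∀ q, N.phi q mu ≤ V)
    (hup : ∀ k, ∀ Q, 0 ≤ Q → N.uplinkValue (lam k) (mu k) Q ≤ V) {a b : Fin K → ℝ}
    (ha : ∀ k, 0 ≤ a k) (hb : ∀ k, 0 ≤ b k)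
    (hupa : ∀ k, N.uplinkValue (a k) (b k) (N.power (lam k) (mu k)) < (∑ k, a k) * V)
    (hphib : ∀ q ∈ N.maximizers mu, N.phi q b < (∑ k, a k) * V) :
    ∃ lam' mu', DualFeasible lam' mu' ∧ N.dual lam' mu' < ((N.T * V : ℝ) : EReal) := by
  have hσ := N.σsq_pos
  have hβ := N.β₀_pos
  have hH := N.H_pos
  set A := ∑ k, a k with hA
  -- On the closed set where the direction does not lower `phi` enough there is no point of value
  -- `V`, so `phi` stays below `V` there by a uniform gap.
  obtain ⟨m', hm'V, hm'⟩ : ∃ m' < V, ∀ q, A * V ≤ N.phi q b → N.phi q mu ≤ m' := by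
    rcases Set.eq_empty_or_nonempty {q | A * V ≤ N.phi q b} with h | h
    · exact ⟨0, hV, fun q hq => absurd hq (Set.eq_empty_iff_forall_notMem.1 h q)⟩
    · obtain ⟨q₁, hq₁, hmax⟩ := N.exists_isMaxOn_phi hK hmu
        (isClosed_le continuous_const (N.continuous_phi b)) h
      refine ⟨N.phi q₁ mu, ?_, hmax⟩
      by_contra! hge
      exact (hphib q₁ fun q => (hphi q).trans hge).not_ge hq₁
  set B := ∑ k, N.η * N.P * b k * (N.β₀ / N.H ^ 2) with hB
  have hid : Filter.Tendsto (fun ε : ℝ => ε) (nhdsWithin 0 (Set.Ioi 0)) (nhds 0) :=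
    Filter.tendsto_id.mono_left nhdsWithin_le_nhds
  have hone : Filter.Tendsto (fun ε : ℝ => 1 - ε * A) (nhdsWithin 0 (Set.Ioi 0)) (nhds 1) := by
    simpa using (hid.mul_const A).const_sub 1
  have hcomb : ∀ x y : ℝ, Filter.Tendsto (fun ε : ℝ => (1 - ε * A) * x + ε * y)
      (nhdsWithin 0 (Set.Ioi 0)) (nhds x) := fun x y => by
    simpa using (hone.mul_const x).add (hid.mul_const y)
  -- The optimal power moves with the multipliers, and the strict inequality persists by continuity
  -- of `power`.
  have hupε : ∀ k, ∀ᶠ ε in nhdsWithin (0 : ℝ) (Set.Ioi 0), N.uplinkValue (a k) (b k)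
      (N.power ((1 - ε * A) * lam k + ε * a k) ((1 - ε * A) * mu k + ε * b k)) < A * V := by
    intro k
    have h1 := N.tendsto_power (hmu k) (hcomb (lam k) (a k)) (hcomb (mu k) (b k))
    have h2 : Filter.Tendsto (fun ε => N.uplinkValue (a k) (b k)
        (N.power ((1 - ε * A) * lam k + ε * a k) ((1 - ε * A) * mu k + ε * b k)))
        (nhdsWithin 0 (Set.Ioi 0)) (nhds (N.uplinkValue (a k) (b k)
          (N.power (lam k) (mu k)))) := by
      have h3 : 1 + N.power (lam k) (mu k) * (N.β₀ / N.H ^ 2) / N.σsq ≠ 0 := by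
        have := N.power_nonneg (lam k) (mu k)
        positivity
      unfold uplinkValue Real.logb
      exact ((((((h1.mul_const _).div_const _).const_add 1).log h3).div_const _).const_mul _).sub
        (h1.const_mul _)
    exact h2.eventually_lt_const (hupa k)
  obtain ⟨ε, hε, h1, h2, h3⟩ := (Filter.Eventually.and
    (eventually_mem_nhdsWithin (a := (0 : ℝ)) (s := Set.Ioi 0))
    ((hone.eventually_const_lt one_pos).and
      ((Filter.eventually_all.2 hupε).and ((hcomb m' B).eventually_lt_const hm'V)))).exists
  replace hε : 0 < ε := hε
  have hd' := dualFeasible_combination hd ha hb hε.le h1.le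
  refine ⟨_, _, hd', dual_lt hK hd' (fun k => ?_) (fun q => ?_) fun k => ?_⟩
  · have := hmu k
    have := hb k
    positivity
  · rw [phi_combination, ← hA]
    -- Either the direction lowers the value at `q`, or the gap `m' < V` absorbs the perturbation,
    -- which is at most `ε * B`.
    by_cases hq : N.phi q b < A * V
    · nlinarith [hphi q]
    · have h4 := hm' q (not_lt.1 hq)
      have h5 := phi_le_sum (N := N) hb q
      rw [← hB] at h5
      nlinarith
  · rw [uplinkValue_combination, ← hA]
    have h4 := hup k _ (N.power_nonneg ((1 - ε * A) * lam k + ε * a k)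
      ((1 - ε * A) * mu k + ε * b k))
    nlinarith [h2 k]

variable (N) in
lemma exists_dualFeasible_le (hK : 1 ≤ K) :
    ∃ lam mu V, DualFeasible lam mu ∧ N.dual lam mu ≤ ((N.T * V : ℝ) : EReal) := by
  have hK0 : (K : ℝ) ≠ 0 := by exact_mod_cast (by omega : K ≠ 0)
  obtain ⟨q, hq⟩ := N.maximizers_nonempty hK (mu := fun _ => 1) fun _ => one_pos
  have hd : DualFeasible (fun _ : Fin K => (K : ℝ)⁻¹) fun _ => 1 :=
    ⟨by simp [hK0], fun _ => by positivity, fun _ => zero_le_one⟩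
  refine ⟨_, _, max (N.phi q fun _ => 1) (N.uplinkValue (K : ℝ)⁻¹ 1 (N.power (K : ℝ)⁻¹ 1)), hd,
    dual_le hd (fun q' => (hq q').trans (le_max_left _ _)) fun k Q hQ => ?_⟩
  exact (N.uplinkValue_le_power (by positivity) one_pos hQ).trans (le_max_right _ _)

variable (N) in
lemma lowerSemicontinuous_dual :
    LowerSemicontinuous fun x : (Fin K → ℝ) × (Fin K → ℝ) => N.dual x.1 x.2 := by
  unfold dual
  refine lowerSemicontinuous_iSup fun s => lowerSemicontinuous_iSup fun _ =>
    lowerSemicontinuous_iSup fun R => Continuous.lowerSemicontinuous ?_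
  refine continuous_coe_real_ereal.comp ?_
  unfold lagrangian
  fun_prop

variable (N) in
-- The value of `phi` above user `k` bounds `mu k` on a sublevel set of the dual function, which
-- thus lies in a compact set; lower semicontinuity gives a minimizer.
lemma exists_isDualOptimal (hK : 1 ≤ K) : ∃ lam mu : Fin K → ℝ, N.IsDualOptimal lam mu := by
  have hη := N.η_pos
  have hP := N.P_pos
  have hβ := N.β₀_pos
  have hH := N.H_pos
  obtain ⟨lam₀, mu₀, V, hd₀, hV⟩ := N.exists_dualFeasible_le hK
  set c := N.η * N.P * (N.β₀ / N.H ^ 2) with hc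
  have hc0 : 0 < c := by positivity
  let C : Set ((Fin K → ℝ) × (Fin K → ℝ)) :=
    stdSimplex ℝ (Fin K) ×ˢ Set.Icc (0 : Fin K → ℝ) fun _ => V / c
  have hC : ∀ lam mu, DualFeasible lam mu → N.dual lam mu ≤ ((N.T * V : ℝ) : EReal) →
      (lam, mu) ∈ C := by
    intro lam mu hd hle
    refine ⟨⟨hd.2.1, hd.1⟩, hd.2.2, fun k => ?_⟩
    have h1 := EReal.coe_le_coe_iff.1 ((N.mul_phi_le_dual lam mu (N.w k)).trans hle)
    have h2 := le_of_mul_le_mul_left h1 N.T_pos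
    have h3 := le_phi_apply (N := N) hd.2.2 k
    change mu k ≤ V / c
    rw [le_div_iff₀ hc0, hc]
    linarith
  have hcomp : IsCompact C := (isCompact_stdSimplex ℝ (Fin K)).prod isCompact_Icc
  obtain ⟨⟨lam, mu⟩, hmem, hmin⟩ := LowerSemicontinuousOn.exists_isMinOn
    ⟨_, hC _ _ hd₀ hV⟩ hcomp (N.lowerSemicontinuous_dual.lowerSemicontinuousOn _)
  have hmin' : ∀ x ∈ C, N.dual lam mu ≤ N.dual x.1 x.2 := fun x hx => isMinOn_iff.1 hmin x hx
  refine ⟨lam, mu, ⟨hmem.1.2, hmem.1.1, fun k => hmem.2.1 k⟩, fun lam' mu' hd' => ?_⟩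
  rcases le_or_gt (N.dual lam' mu') ((N.T * V : ℝ) : EReal) with h | h
  · exact hmin' (lam', mu') (hC _ _ hd' h)
  · exact ((hmin' (lam₀, mu₀) (hC _ _ hd₀ hV)).trans hV).trans h.le

namespace IsDualOptimal

variable {lam mu : Fin K → ℝ}

lemma exists_value (hopt : N.IsDualOptimal lam mu)
    (hK : 1 ≤ K) : ∃ V : ℝ, 0 < V ∧ N.dual lam mu = ((N.T * V : ℝ) : EReal) ∧
    (∀ q, N.phi q mu ≤ V) ∧ ∀ k, ∀ Q, 0 ≤ Q → N.uplinkValue (lam k) (mu k) Q ≤ V := by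
  have hT := N.T_pos
  have hη := N.η_pos
  have hP := N.P_pos
  have hβ := N.β₀_pos
  have hH := N.H_pos
  have hσ := N.σsq_pos
  obtain ⟨lam₀, mu₀, V₀, hd₀, hV₀⟩ := N.exists_dualFeasible_le hK
  have hlt : N.dual lam mu ≠ ⊤ :=
    (((hopt.2 _ _ hd₀).trans hV₀).trans_lt (EReal.coe_lt_top _)).ne
  have hgt : N.dual lam mu ≠ ⊥ :=
    ((EReal.bot_lt_coe _).trans_le (N.mul_phi_le_dual lam mu 0)).ne'
  obtain ⟨V, hV⟩ : ∃ V : ℝ, N.dual lam mu = ((N.T * V : ℝ) : EReal) :=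
    ⟨(N.dual lam mu).toReal / N.T, by
      rw [mul_div_cancel₀ _ hT.ne', EReal.coe_toReal hlt hgt]⟩
  have hphi : ∀ q, N.phi q mu ≤ V := fun q =>
    le_of_mul_le_mul_left (EReal.coe_le_coe_iff.1 (hV ▸ N.mul_phi_le_dual lam mu q)) hT
  have hup : ∀ k, ∀ Q, 0 ≤ Q → N.uplinkValue (lam k) (mu k) Q ≤ V := fun k Q hQ =>
    le_of_mul_le_mul_left
      (EReal.coe_le_coe_iff.1 (hV ▸ N.mul_uplinkValue_le_dual lam mu k hQ)) hT
  refine ⟨V, ?_, hV, hphi, hup⟩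
  by_contra! hV0
  -- If `V ≤ 0`, then `phi` above a user `j` with `lam j > 0` forces `mu j = 0`; energy is then free
  -- for that user, and its density at `Q = 1` is positive.
  obtain ⟨j, -, hj⟩ : ∃ j ∈ Finset.univ, (0 : ℝ) < lam j :=
    Finset.exists_lt_of_sum_lt (f := fun _ => (0 : ℝ)) (by simp [hopt.1.1])
  have h1 := (le_phi_apply (N := N) hopt.1.2.2 j).trans ((hphi _).trans hV0)
  have hmuj : mu j = 0 := by
    refine le_antisymm ?_ (hopt.1.2.2 j)
    by_contra! h
    have : 0 < N.η * N.P * mu j * (N.β₀ / N.H ^ 2) := by positivity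
    linarith
  have h2 := (hup j 1 zero_le_one).trans hV0
  rw [uplinkValue, hmuj, zero_mul, sub_zero] at h2
  have h3 : 0 < Real.logb 2 (1 + 1 * (N.β₀ / N.H ^ 2) / N.σsq) := by
    refine Real.logb_pos one_lt_two ?_
    have : 0 < 1 * (N.β₀ / N.H ^ 2) / N.σsq := by positivity
    linarith
  have : 0 < lam j / N.T * Real.logb 2 (1 + 1 * (N.β₀ / N.H ^ 2) / N.σsq) := by positivity
  linarith

/-- If `mu k = 0`, then also `lam k = 0`, since otherwise the density of user `k` is unbounded in
`Q`. User `k` is then idle in the dual, and shifting a little weight to it scales down all other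
pieces, contradicting optimality. -/
lemma mu_pos (hopt : N.IsDualOptimal lam mu) (hK : 1 ≤ K) (k : Fin K) : 0 < mu k := by
  classical
  have hT := N.T_pos
  have hη := N.η_pos
  have hP := N.P_pos
  have hβ := N.β₀_pos
  have hH := N.H_pos
  have hσ := N.σsq_pos
  obtain ⟨V, hV0, hV, hphi, hup⟩ := hopt.exists_value hK
  refine (hopt.1.2.2 k).lt_of_ne' fun hmuk => ?_
  have hlamk : lam k = 0 := by
    refine le_antisymm ?_ (hopt.1.2.1 k)
    by_contra! hpos
    -- The power used next makes the logarithm equal to `x`, hence the density equal to `V + 1`.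
    set x := N.T * (V + 1) / lam k with hx
    have hx0 : 0 ≤ x := by positivity
    have h1 := hup k (((2 : ℝ) ^ x - 1) / (N.β₀ / N.H ^ 2 / N.σsq)) (by
      have := Real.one_le_rpow one_le_two hx0
      exact div_nonneg (by linarith) (by positivity))
    have h2 : 1 + ((2 : ℝ) ^ x - 1) / (N.β₀ / N.H ^ 2 / N.σsq) * (N.β₀ / N.H ^ 2) / N.σsq
        = 2 ^ x := by
      field_simp
      ring
    rw [uplinkValue, h2, Real.logb_rpow (by norm_num) (by norm_num), hmuk, hx] at h1
    have h3 : lam k / N.T * (N.T * (V + 1) / lam k) = V + 1 := by field_simp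
    rw [h3] at h1
    linarith
  set c := N.η * N.P * (N.β₀ / N.H ^ 2) with hc
  have hc0 : 0 < c := by positivity
  -- With this price for user `k` alone, `phi` is at most `V / 2` everywhere.
  set d := V / (2 * c) with hd
  have hd0 : 0 < d := by positivity
  set M := N.uplinkValue 1 d (N.power 1 d) with hM
  obtain ⟨ε, hε0, hε1, hεM⟩ : ∃ ε : ℝ, 0 < ε ∧ ε < 1 ∧ ε * M < V := by
    have h1 : Filter.Tendsto (fun ε : ℝ => ε) (nhdsWithin 0 (Set.Ioi 0)) (nhds 0) :=
      Filter.tendsto_id.mono_left nhdsWithin_le_nhds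
    have h2 : Filter.Tendsto (fun ε : ℝ => ε * M) (nhdsWithin 0 (Set.Ioi 0)) (nhds 0) := by
      simpa using h1.mul_const M
    exact (Filter.Eventually.and
    (eventually_mem_nhdsWithin (a := (0 : ℝ)) (s := Set.Ioi 0)) ((h1.eventually_lt_const one_pos).and
      (h2.eventually_lt_const hV0))).exists
  set a : Fin K → ℝ := Pi.single k 1 with ha
  set b : Fin K → ℝ := Pi.single k d with hb
  have ha0 : ∀ j, 0 ≤ a j := fun j => (Pi.single_nonneg.2 zero_le_one : 0 ≤ a) j
  have hb0 : ∀ j, 0 ≤ b j := fun j => (Pi.single_nonneg.2 hd0.le : 0 ≤ b) j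
  have hA : ∑ j, a j = 1 := by simp [ha]
  have hfeas := dualFeasible_combination hopt.1 ha0 hb0 hε0.le (by rw [hA]; linarith)
  rw [hA, mul_one] at hfeas
  have hV' : max ((1 - ε / 2) * V) (ε * M) < V := max_lt (by nlinarith) hεM
  refine ((hopt.2 _ _ hfeas).trans (dual_le (V := max ((1 - ε / 2) * V) (ε * M)) hfeas
    (fun q => ?_) fun j Q hQ => ?_)).not_gt ?_
  · refine le_trans ?_ (le_max_left _ _)
    rw [phi_combination]
    have h1 : N.phi q b ≤ V / 2 := by
      refine (phi_le_sum hb0 q).trans_eq ?_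
      rw [Finset.sum_eq_single k (by intro j _ hj; simp [hb, hj]) (by simp)]
      simp only [hb, Pi.single_eq_same, hd]
      rw [mul_right_comm, ← hc]
      field_simp
    nlinarith [hphi q]
  · rw [uplinkValue_combination]
    by_cases hj : j = k
    · subst hj
      refine le_trans ?_ (le_max_right _ _)
      simp only [hlamk, hmuk, ha, hb, Pi.single_eq_same]
      have h1 : N.uplinkValue 0 0 Q = 0 := by simp [uplinkValue]
      rw [h1, mul_zero, zero_add]
      exact mul_le_mul_of_nonneg_left (N.uplinkValue_le_power zero_le_one hd0 hQ) hε0.le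
    · refine le_trans ?_ (le_max_left _ _)
      have h1 : N.uplinkValue (a j) (b j) Q = 0 := by simp [uplinkValue, ha, hb, hj]
      rw [h1, mul_zero, add_zero]
      nlinarith [hup j Q hQ]
  · rw [hV]
    exact EReal.coe_lt_coe_iff.2 (mul_lt_mul_of_pos_left hV' hT)

/-- Strong duality: the linear program attains the dual value. -/
lemma exists_lpFeasible (hopt : N.IsDualOptimal lam mu)
    (hK : 1 ≤ K) {V : ℝ} (hV : N.dual lam mu = ((N.T * V : ℝ) : EReal))
    {Ω : ℕ} {qbar : Fin Ω → Plane} (hq : Set.range qbar = N.maximizers mu) :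
    ∃ ς τ, N.LPFeasible lam mu qbar ς τ (N.T * V) := by
  classical
  have hT := N.T_pos
  have hmu := hopt.mu_pos hK
  obtain ⟨V', hV0, hV', hphi, hup⟩ := hopt.exists_value hK
  obtain rfl : V = V' := mul_left_cancel₀ hT.ne' (EReal.coe_eq_coe_iff.1 (hV.symm.trans hV'))
  let r : Fin K → ℝ := fun k =>
    Real.logb 2 (1 + N.power (lam k) (mu k) * N.gain k (N.w k) / N.σsq)
  -- Each column records the throughputs and energy balances if the whole period is spent in one
  -- hovering mode; `θ` will be the fractions of time.
  let p : Fin K ⊕ Fin Ω → Fin K ⊕ Fin K → ℝ := Sum.elim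
    (fun k => Sum.elim (fun j => if j = k then r k else 0)
      fun j => if j = k then -(N.T * N.power (lam k) (mu k)) else 0)
    (fun ω => Sum.elim (fun _ => 0) fun j => N.T * (N.η * N.P * N.gain j (qbar ω)))
  let b : Fin K ⊕ Fin K → ℝ := Sum.elim (fun _ => N.T * V) fun _ => 0
  rcases exists_stdSimplex_or_exists_separating p b with ⟨θ, hθ, hθb⟩ | ⟨a, ha, hab⟩
  · refine ⟨fun k => N.T * θ (Sum.inl k), fun ω => N.T * θ (Sum.inr ω), ?_, ?_, ?_, ?_, ?_⟩
    · exact fun k => mul_nonneg hT.le (hθ.1 _)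
    · exact fun k => mul_nonneg hT.le (hθ.1 _)
    · intro k
      have h1 := hθb (Sum.inl k)
      simp only [b, p, Fintype.sum_sum_type, Sum.elim_inl, Sum.elim_inr, mul_ite, mul_zero,
        Finset.sum_ite_eq, Finset.mem_univ, if_true, Finset.sum_const_zero, add_zero] at h1
      rwa [mul_div_cancel_left₀ _ hT.ne']
    · intro k
      have h1 := hθb (Sum.inr k)
      simp only [b, p, Fintype.sum_sum_type, Sum.elim_inl, Sum.elim_inr, mul_ite, mul_zero,
        Finset.sum_ite_eq, Finset.mem_univ, if_true] at h1
      have h2 : ∑ ω, N.T * θ (Sum.inr ω) * (N.η * N.P * N.gain k (qbar ω)) =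
          ∑ ω, θ (Sum.inr ω) * (N.T * (N.η * N.P * N.gain k (qbar ω))) :=
        Finset.sum_congr rfl fun ω _ => by ring
      rw [h2]
      linarith
    · have h1 := hθ.2
      rw [Fintype.sum_sum_type] at h1
      rw [← Finset.mul_sum, ← Finset.mul_sum, ← mul_add, h1, mul_one]
  -- The two blocks of the functional are directions for `lam` and `mu`. Its inequalities at the
  -- columns say that every active piece decreases.
  · exfalso
    simp only [b, Fintype.sum_sum_type, Sum.elim_inl, Sum.elim_inr, mul_zero,
      Finset.sum_const_zero, add_zero, ← Finset.sum_mul] at hab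
    obtain ⟨lam', mu', hd', hlt⟩ := exists_dual_lt hK hopt.1 hmu hV0 hphi hup
      (a := fun k => a (Sum.inl k)) (b := fun k => a (Sum.inr k)) (fun k => ha _) (fun k => ha _)
      (fun k => by
        have h1 := hab (Sum.inl k)
        simp only [p, Sum.elim_inl, Sum.elim_inr, mul_ite, mul_zero,
          Finset.sum_ite_eq', Finset.mem_univ, if_true] at h1
        have h2 : N.T * N.uplinkValue (a (Sum.inl k)) (a (Sum.inr k)) (N.power (lam k) (mu k)) =
            a (Sum.inl k) * r k + a (Sum.inr k) * -(N.T * N.power (lam k) (mu k)) := by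
          simp only [uplinkValue, r, gain_self]
          field_simp
          ring
        rw [← h2] at h1
        refine lt_of_mul_lt_mul_left ?_ hT.le
        linarith)
      (fun q hqm => by
        obtain ⟨ω, rfl⟩ := hq.symm ▸ hqm
        have h1 := hab (Sum.inr ω)
        simp only [p, Sum.elim_inl, Sum.elim_inr, mul_zero, Finset.sum_const_zero, zero_add] at h1
        have h2 : N.T * N.phi (qbar ω) (fun k => a (Sum.inr k)) =
            ∑ k, a (Sum.inr k) * (N.T * (N.η * N.P * N.gain k (qbar ω))) := by
          rw [phi, Finset.mul_sum]
          exact Finset.sum_congr rfl fun k _ => by ring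
        rw [← h2] at h1
        refine lt_of_mul_lt_mul_left ?_ hT.le
        linarith)
    exact (hV ▸ hopt.2 _ _ hd').not_gt hlt

end IsDualOptimal

end Network

/-! ### Consecutive intervals and hovering schedules -/

section Stacked

variable {n : ℕ} {d : Fin n → ℝ}

lemma pairwise_disjoint_stacked (hd : ∀ i, 0 ≤ d i) (a : ℝ) :
    Pairwise (Function.onFun Disjoint fun i =>
    Set.Ioc (a + ∑ j ∈ Finset.Iio i, d j) (a + ∑ j ∈ Finset.Iic i, d j)) := by
  refine (pairwise_disjoint_on _).2 fun i j hij => ?_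
  refine Set.disjoint_left.2 fun t h1 h2 => ?_
  have : ∑ l ∈ Finset.Iic i, d l ≤ ∑ l ∈ Finset.Iio j, d l :=
    Finset.sum_le_sum_of_subset_of_nonneg
      (fun l hl => Finset.mem_Iio.2 ((Finset.mem_Iic.1 hl).trans_lt hij)) fun l _ _ => hd l
  linarith [h1.2, h2.1]

lemma iUnion_stacked (hd : ∀ i, 0 ≤ d i) (a : ℝ) :
    ⋃ i, Set.Ioc (a + ∑ j ∈ Finset.Iio i, d j) (a + ∑ j ∈ Finset.Iic i, d j) =
      Set.Ioc a (a + ∑ j, d j) := by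
  refine Set.Subset.antisymm (Set.iUnion_subset fun i => Set.Ioc_subset_Ioc ?_ ?_) fun t ht => ?_
  · exact le_add_of_nonneg_right (Finset.sum_nonneg fun j _ => hd j)
  · exact add_le_add_right (Finset.sum_le_sum_of_subset_of_nonneg (Finset.subset_univ _)
      fun l _ _ => hd l) a
  · have hn : n ≠ 0 := by
      rintro rfl
      simp at ht
    obtain ⟨m, rfl⟩ := Nat.exists_eq_succ_of_ne_zero hn
    have hex : ∃ i, t ≤ a + ∑ j ∈ Finset.Iic i, d j := by
      refine ⟨Fin.last m, ?_⟩
      rw [← Fin.top_eq_last, Finset.Iic_top]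
      exact ht.2
    -- The first interval ending at or after `t` contains it: by minimality the previous one, if
    -- any, ends before `t`.
    obtain ⟨i, hi, hmin⟩ := WellFounded.has_min (wellFounded_lt (α := Fin (m + 1)))
      {i | t ≤ a + ∑ j ∈ Finset.Iic i, d j} hex
    refine Set.mem_iUnion.2 ⟨i, ?_, hi⟩
    induction i using Fin.cases with
    | zero =>
      have : Finset.Iio (0 : Fin (m + 1)) = ∅ := by ext; simp
      simpa [this] using ht.1
    | succ i =>
      have h1 := hmin i.castSucc
      have h2 : Finset.Iio i.succ = Finset.Iic i.castSucc := by
        ext l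
        rw [Finset.mem_Iio, Finset.mem_Iic, Fin.lt_def, Fin.le_def, Fin.val_succ, Fin.val_castSucc,
          Nat.lt_succ_iff]
      rw [h2]
      by_contra! h3
      exact h1 h3 Fin.castSucc_lt_succ

end Stacked

namespace Network

variable {K : ℕ} {N : Network K}

/-- The sub-periods of a hovering schedule. -/
def subPeriod {Ω : ℕ} (ς : Fin K → ℝ) (τ : Fin Ω → ℝ) : Fin Ω ⊕ Fin K → Set ℝ :=
  Sum.elim (downlinkPeriod τ) (uplinkPeriod ς τ)

section SubPeriod

variable {Ω : ℕ} {ς : Fin K → ℝ} {τ : Fin Ω → ℝ}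

lemma measurableSet_subPeriod (i : Fin Ω ⊕ Fin K) : MeasurableSet (subPeriod ς τ i) := by
  cases i <;> exact measurableSet_Ioc

lemma iUnion_downlinkPeriod (hτ : ∀ ω, 0 ≤ τ ω) :
    ⋃ ω, downlinkPeriod τ ω = Set.Ioc 0 (∑ ω, τ ω) := by
  simpa [downlinkPeriod] using iUnion_stacked hτ 0

lemma iUnion_uplinkPeriod (hς : ∀ k, 0 ≤ ς k) :
    ⋃ k, uplinkPeriod ς τ k = Set.Ioc (∑ ω, τ ω) (∑ ω, τ ω + ∑ k, ς k) :=
  iUnion_stacked hς _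

lemma iUnion_subPeriod (hς : ∀ k, 0 ≤ ς k) (hτ : ∀ ω, 0 ≤ τ ω) :
    ⋃ i, subPeriod ς τ i = Set.Ioc 0 (∑ k, ς k + ∑ ω, τ ω) := by
  rw [Set.iUnion_sum]
  simp only [subPeriod, Sum.elim_inl, Sum.elim_inr]
  rw [iUnion_downlinkPeriod hτ, iUnion_uplinkPeriod hς, Set.Ioc_union_Ioc_eq_Ioc, add_comm]
  · exact Finset.sum_nonneg fun ω _ => hτ ω
  · exact le_add_of_nonneg_right (Finset.sum_nonneg fun k _ => hς k)

lemma pairwise_disjoint_subPeriod (hς : ∀ k, 0 ≤ ς k) (hτ : ∀ ω, 0 ≤ τ ω) :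
    Pairwise (Function.onFun Disjoint (subPeriod ς τ)) := by
  have hcross : ∀ ω k, Disjoint (downlinkPeriod τ ω) (uplinkPeriod ς τ k) := fun ω k => by
    refine Set.disjoint_left.2 fun t h1 h2 => ?_
    have h3 := (iUnion_downlinkPeriod hτ).subset (Set.mem_iUnion_of_mem ω h1)
    have h4 := (iUnion_uplinkPeriod hς).subset (Set.mem_iUnion_of_mem k h2)
    linarith [h3.2, h4.1]
  rintro (ω | k) (ω' | k') h
  · have := pairwise_disjoint_stacked hτ 0 (fun h' => h (congrArg _ h') : ω ≠ ω')
    simpa [Function.onFun, subPeriod, downlinkPeriod] using this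
  · exact hcross ω k'
  · exact (hcross ω' k).symm
  · exact pairwise_disjoint_stacked hς _ (fun h' => h (congrArg _ h') : k ≠ k')

lemma volume_real_subPeriod (hς : ∀ k, 0 ≤ ς k) (hτ : ∀ ω, 0 ≤ τ ω) (i : Fin Ω ⊕ Fin K) :
    volume.real (subPeriod ς τ i) = Sum.elim τ ς i := by
  have key : ∀ {n : ℕ} (d : Fin n → ℝ) (i : Fin n),
      ∑ j ∈ Finset.Iic i, d j = d i + ∑ j ∈ Finset.Iio i, d j := fun d i => by
    rw [← Finset.Iio_insert, Finset.sum_insert (by simp)]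
  rcases i with ω | k
  · simp only [subPeriod, Sum.elim_inl, downlinkPeriod]
    rw [Real.volume_real_Ioc_of_le (by linarith [key τ ω, hτ ω]), key]
    ring
  · simp only [subPeriod, Sum.elim_inr, uplinkPeriod]
    rw [Real.volume_real_Ioc_of_le (by linarith [key ς k, hς k]), key]
    ring

end SubPeriod

section Hovering

variable {lam mu : Fin K → ℝ} {Ω : ℕ} {qbar : Fin Ω → Plane} {ς : Fin K → ℝ} {τ : Fin Ω → ℝ}

lemma exists_mem_subPeriod (hς : ∀ k, 0 ≤ ς k) (hτ : ∀ ω, 0 ≤ τ ω)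
    (htot : ∑ k, ς k + ∑ ω, τ ω = N.T)
    {t : ℝ} (ht : t ∈ Set.Ioc 0 N.T) : ∃ i, t ∈ subPeriod ς τ i := by
  rw [← htot, ← iUnion_subPeriod hς hτ] at ht
  exact Set.mem_iUnion.1 ht

lemma periodMeasure_eq (hς : ∀ k, 0 ≤ ς k) (hτ : ∀ ω, 0 ≤ τ ω)
    (htot : ∑ k, ς k + ∑ ω, τ ω = N.T) :
    N.periodMeasure = volume.restrict (⋃ i, subPeriod ς τ i) := by
  rw [iUnion_subPeriod hς hτ, htot]
  rfl

lemma aemeasurable_of_piecewise_const (hς : ∀ k, 0 ≤ ς k) (hτ : ∀ ω, 0 ≤ τ ω)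
    (htot : ∑ k, ς k + ∑ ω, τ ω = N.T)
    {E : Type*} [MeasurableSpace E] {f : ℝ → E}
    {c : Fin Ω ⊕ Fin K → E} (hf : ∀ i, ∀ t ∈ subPeriod ς τ i, f t = c i) :
    AEMeasurable f N.periodMeasure := by
  rw [periodMeasure_eq hς hτ htot, aemeasurable_iUnion_iff]
  intro i
  refine (aemeasurable_const (b := c i)).congr ?_
  filter_upwards [ae_restrict_mem (measurableSet_subPeriod i)] with t ht
  exact (hf i t ht).symm

lemma integrableOn_of_piecewise_const  {f : ℝ → ℝ} {c : Fin Ω ⊕ Fin K → ℝ}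
    (hf : ∀ i, ∀ t ∈ subPeriod ς τ i, f t = c i) (i : Fin Ω ⊕ Fin K) :
    IntegrableOn f (subPeriod ς τ i) := by
  have hfin : volume (subPeriod ς τ i) ≠ ⊤ := by
    cases i <;> exact measure_Ioc_lt_top.ne
  refine (integrableOn_const hfin (C := c i)).congr_fun ?_ (measurableSet_subPeriod i)
  exact fun t ht => (hf i t ht).symm

lemma integrable_of_piecewise_const (hς : ∀ k, 0 ≤ ς k) (hτ : ∀ ω, 0 ≤ τ ω)
    (htot : ∑ k, ς k + ∑ ω, τ ω = N.T)
    {f : ℝ → ℝ} {c : Fin Ω ⊕ Fin K → ℝ}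
    (hf : ∀ i, ∀ t ∈ subPeriod ς τ i, f t = c i) : Integrable f N.periodMeasure := by
  rw [periodMeasure_eq hς hτ htot]
  exact integrableOn_finite_iUnion.2 (integrableOn_of_piecewise_const hf)

lemma integral_of_piecewise_const (hς : ∀ k, 0 ≤ ς k) (hτ : ∀ ω, 0 ≤ τ ω)
    (htot : ∑ k, ς k + ∑ ω, τ ω = N.T)
    {f : ℝ → ℝ} {c : Fin Ω ⊕ Fin K → ℝ}
    (hf : ∀ i, ∀ t ∈ subPeriod ς τ i, f t = c i) :
    ∫ t, f t ∂N.periodMeasure = ∑ ω, τ ω * c (Sum.inl ω) + ∑ k, ς k * c (Sum.inr k) := by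
  rw [periodMeasure_eq hς hτ htot, integral_iUnion_fintype measurableSet_subPeriod
    (pairwise_disjoint_subPeriod hς hτ) (integrableOn_of_piecewise_const hf)]
  have h : ∀ i, ∫ t in subPeriod ς τ i, f t = Sum.elim τ ς i * c i := fun i => by
    rw [setIntegral_congr_fun (measurableSet_subPeriod i) fun t ht => hf i t ht,
      setIntegral_const, volume_real_subPeriod hς hτ, smul_eq_mul]
  simp [h]

variable (N) in
lemma exists_isHovering (hς : ∀ k, 0 ≤ ς k) (hτ : ∀ ω, 0 ≤ τ ω) :
    ∃ s : Schedule K, N.IsHovering lam mu qbar ς τ s := by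
  classical
  -- The sub-periods are disjoint, so the chosen index is the only possible one; the value 0
  -- elsewhere is arbitrary.
  let S : Schedule K :=
    { ρ := fun i t => if h : ∃ x, t ∈ subPeriod ς τ x then
        Sum.elim (fun _ => if i = 0 then 1 else 0) (fun k => if i = k.succ then 1 else 0) h.choose
        else 0
      Q := fun j t => if h : ∃ x, t ∈ subPeriod ς τ x then
        Sum.elim (fun _ => 0) (fun k => if j = k then N.power (lam k) (mu k) else 0) h.choose
        else 0
      q := fun t => if h : ∃ x, t ∈ subPeriod ς τ x then Sum.elim qbar N.w h.choose else 0 }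
  have hch : ∀ x t (ht : t ∈ subPeriod ς τ x) (h : ∃ x, t ∈ subPeriod ς τ x), h.choose = x := by
    intro x t ht h
    by_contra hne
    exact Set.disjoint_left.1 (pairwise_disjoint_subPeriod hς hτ hne) h.choose_spec ht
  refine ⟨S, fun ω t ht => ?_, fun k t ht => ?_⟩
  · have hm : t ∈ subPeriod ς τ (Sum.inl ω) := ht
    have h : ∃ x, t ∈ subPeriod ς τ x := ⟨_, hm⟩
    simp only [S, dif_pos h, hch _ t hm h, Sum.elim_inl]
    simp
  · have hm : t ∈ subPeriod ς τ (Sum.inr k) := ht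
    have h : ∃ x, t ∈ subPeriod ς τ x := ⟨_, hm⟩
    simp only [S, dif_pos h, hch _ t hm h, Sum.elim_inr]
    simp +contextual [(Fin.succ_ne_zero _).symm]

variable {s : Schedule K}

lemma IsHovering.location_eq (hs : N.IsHovering lam mu qbar ς τ s)
    (i : Fin Ω ⊕ Fin K) {t : ℝ} (ht : t ∈ subPeriod ς τ i) :
    s.q t = Sum.elim qbar N.w i := by
  rcases i with ω | k
  · exact (hs.downlink ω t ht).1
  · exact (hs.uplink k t ht).1

lemma IsHovering.mode_zero_eq (hs : N.IsHovering lam mu qbar ς τ s)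
    (i : Fin Ω ⊕ Fin K) {t : ℝ} (ht : t ∈ subPeriod ς τ i) :
    s.ρ 0 t = Sum.elim (fun _ => 1) (fun _ => 0) i := by
  rcases i with ω | k
  · exact (hs.downlink ω t ht).2.1
  · exact (hs.uplink k t ht).2.2.2.1

lemma IsHovering.mode_succ_eq (hs : N.IsHovering lam mu qbar ς τ s)
    (j : Fin K) (i : Fin Ω ⊕ Fin K) {t : ℝ}
    (ht : t ∈ subPeriod ς τ i) :
    s.ρ j.succ t = Sum.elim (fun _ => 0) (fun k => if j = k then 1 else 0) i := by
  rcases i with ω | k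
  · exact ((hs.downlink ω t ht).2.2 j).1
  · obtain ⟨-, h1, -, -, h2⟩ := hs.uplink k t ht
    by_cases h : j = k
    · simpa [h] using h1
    · simpa [h] using (h2 j h).1

lemma IsHovering.power_eq (hs : N.IsHovering lam mu qbar ς τ s)
    (j : Fin K) (i : Fin Ω ⊕ Fin K) {t : ℝ}
    (ht : t ∈ subPeriod ς τ i) :
    s.Q j t = Sum.elim (fun _ => 0) (fun k => if j = k then N.power (lam j) (mu j) else 0) i := by
  rcases i with ω | k
  · exact ((hs.downlink ω t ht).2.2 j).2
  · obtain ⟨-, -, h1, -, h2⟩ := hs.uplink k t ht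
    by_cases h : j = k
    · simpa [h] using h1
    · simpa [h] using (h2 j h).2

/-- The sub-periods cover the period, so all variables are step functions there, whatever their
values outside. -/
lemma IsHovering.admissible (hς : ∀ k, 0 ≤ ς k) (hτ : ∀ ω, 0 ≤ τ ω)
    (htot : ∑ k, ς k + ∑ ω, τ ω = N.T) (hs : N.IsHovering lam mu qbar ς τ s) :
    N.Admissible s where
  binary j t ht := by
    obtain ⟨i, hi⟩ := exists_mem_subPeriod hς hτ htot ht
    induction j using Fin.cases with
    | zero =>
      rw [hs.mode_zero_eq i hi]
      cases i <;> simp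
    | succ j =>
      rw [hs.mode_succ_eq j i hi]
      cases i <;> simp
      tauto
  sum_eq_one t ht := by
    obtain ⟨i, hi⟩ := exists_mem_subPeriod hς hτ htot ht
    rw [Fin.sum_univ_succ, hs.mode_zero_eq i hi]
    simp_rw [fun j => hs.mode_succ_eq j i hi]
    cases i <;> simp
  power_nonneg k t ht := by
    obtain ⟨i, hi⟩ := exists_mem_subPeriod hς hτ htot ht
    rw [hs.power_eq k i hi]
    cases i
    · simp
    · simp only [Sum.elim_inr]
      split_ifs
      · exact N.power_nonneg _ _
      · exact le_rfl
  measurable_ρ j := by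
    induction j using Fin.cases with
    | zero => exact aemeasurable_of_piecewise_const hς hτ htot fun i t ht => hs.mode_zero_eq i ht
    | succ j => exact aemeasurable_of_piecewise_const hς hτ htot fun i t ht => hs.mode_succ_eq j i ht
  measurable_Q k := aemeasurable_of_piecewise_const hς hτ htot fun i t ht => hs.power_eq k i ht
  measurable_q := aemeasurable_of_piecewise_const hς hτ htot fun i t ht => hs.location_eq i ht
  integrable k := integrable_of_piecewise_const hς hτ htot fun i t ht =>
    congrArg₂ (· * ·) (hs.mode_succ_eq k i ht) (hs.power_eq k i ht)

lemma IsHovering.consumedEnergy_eq (hς : ∀ k, 0 ≤ ς k) (hτ : ∀ ω, 0 ≤ τ ω)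
    (htot : ∑ k, ς k + ∑ ω, τ ω = N.T) (hs : N.IsHovering lam mu qbar ς τ s)
    (k : Fin K) :
    N.consumedEnergy s k = ς k * N.power (lam k) (mu k) := by
  rw [consumedEnergy, integral_of_piecewise_const hς hτ htot fun i t ht =>
    congrArg₂ (· * ·) (hs.mode_succ_eq k i ht) (hs.power_eq k i ht)]
  simp

lemma IsHovering.harvestedEnergy_eq (hς : ∀ k, 0 ≤ ς k) (hτ : ∀ ω, 0 ≤ τ ω)
    (htot : ∑ k, ς k + ∑ ω, τ ω = N.T) (hs : N.IsHovering lam mu qbar ς τ s)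
    (k : Fin K) :
    N.harvestedEnergy s k = ∑ ω, τ ω * (N.η * N.P * N.gain k (qbar ω)) := by
  rw [harvestedEnergy, integral_of_piecewise_const hς hτ htot fun i t ht =>
    congrArg₂ (N.harvest k) (hs.mode_zero_eq i ht) (hs.location_eq i ht)]
  simp [harvest]

lemma IsHovering.throughput_eq (hς : ∀ k, 0 ≤ ς k) (hτ : ∀ ω, 0 ≤ τ ω)
    (htot : ∑ k, ς k + ∑ ω, τ ω = N.T) (hs : N.IsHovering lam mu qbar ς τ s)
    (k : Fin K) :
    N.throughput s k = ς k / N.T *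
      Real.logb 2 (1 + N.power (lam k) (mu k) * N.gain k (N.w k) / N.σsq) := by
  rw [throughput, integral_of_piecewise_const hς hτ htot (c := fun i => N.rate k
    (Sum.elim (fun _ => 0) (fun j => if k = j then 1 else 0) i) (Sum.elim qbar N.w i)
    (Sum.elim (fun _ => 0) (fun j => if k = j then N.power (lam k) (mu k) else 0) i))
    fun i t ht => by
      rw [hs.mode_succ_eq k i ht, hs.location_eq i ht, hs.power_eq k i ht]]
  simp [rate]
  ring

end Hovering

/-! ### Weak duality and the passage between the problems -/

variable {lam mu : Fin K → ℝ} {Ω : ℕ} {qbar : Fin Ω → Plane} {ς : Fin K → ℝ} {τ : Fin Ω → ℝ}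

lemma LPFeasible.epiFeasible {R : ℝ} (h : N.LPFeasible lam mu qbar ς τ R) {s : Schedule K}
    (hs : N.IsHovering lam mu qbar ς τ s) : N.EpiFeasible s R := by
  refine ⟨⟨hs.admissible h.ς_nonneg h.τ_nonneg h.total_time, fun k => ?_⟩, fun k => ?_⟩
  · rw [hs.consumedEnergy_eq h.ς_nonneg h.τ_nonneg h.total_time,
      hs.harvestedEnergy_eq h.ς_nonneg h.τ_nonneg h.total_time]
    exact h.energy_le k
  · rw [hs.throughput_eq h.ς_nonneg h.τ_nonneg h.total_time]
    exact h.throughput_ge k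

/-- Weak duality. -/
lemma EpiFeasible.le_dual {s : Schedule K} {R : ℝ} (h : N.EpiFeasible s R)
    (hd : DualFeasible lam mu) : (R : EReal) ≤ N.dual lam mu := by
  refine le_trans (EReal.coe_le_coe_iff.2 ?_) (lagrangian_le_dual h.1.1 0 lam mu)
  rw [lagrangian, mul_zero, zero_add]
  have h1 : R ≤ ∑ k, lam k * N.throughput s k := by
    calc R = ∑ k, lam k * R := by rw [← Finset.sum_mul, hd.1, one_mul]
      _ ≤ _ := Finset.sum_le_sum fun k _ => mul_le_mul_of_nonneg_left (h.2 k) (hd.2.1 k)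
  have h2 : 0 ≤ ∑ k, mu k * (N.harvestedEnergy s k - N.consumedEnergy s k) :=
    Finset.sum_nonneg fun k _ => mul_nonneg (hd.2.2 k) (sub_nonneg.2 (h.1.2 k))
  linarith

lemma Feasible.epiFeasible_commonThroughput {s : Schedule K} (h : N.Feasible s) :
    N.EpiFeasible s (N.commonThroughput s) :=
  ⟨h, fun k => ciInf_le (Set.finite_range _).bddBelow k⟩

lemma IsEpiOptimal.commonThroughput_eq (hK : 1 ≤ K) {s : Schedule K} {R : ℝ}
    (h : N.IsEpiOptimal s R) : N.commonThroughput s = R := by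
  have : Nonempty (Fin K) := ⟨⟨0, hK⟩⟩
  exact le_antisymm (h.2 s _ h.1.1.epiFeasible_commonThroughput) (le_ciInf h.1.2)

lemma IsEpiOptimal.isOptimal (hK : 1 ≤ K) {s : Schedule K} {R : ℝ} (h : N.IsEpiOptimal s R) :
    N.IsOptimal s :=
  ⟨h.1.1, fun s' hs' => (h.2 s' _ hs'.epiFeasible_commonThroughput).trans_eq
    (h.commonThroughput_eq hK).symm⟩

end Network
end UAV

end

theorem proposition3p3 {K : ℕ} (hK : 1 ≤ K) (N : UAV.Network K) :
    (∃ lam mu : Fin K → ℝ, N.IsDualOptimal lam mu) ∧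
    ∀ lam mu : Fin K → ℝ, N.IsDualOptimal lam mu →
      (∀ k, 0 < mu k) ∧ (N.maximizers mu).Finite ∧ (N.maximizers mu).Nonempty ∧
      ∀ (Ω : ℕ) (qbar : Fin Ω → UAV.Plane),
        Function.Injective qbar → Set.range qbar = N.maximizers mu →
        (∃ (ς : Fin K → ℝ) (τ : Fin Ω → ℝ) (R : ℝ), N.IsLPOptimal lam mu qbar ς τ R) ∧
        ∀ (ς : Fin K → ℝ) (τ : Fin Ω → ℝ) (R : ℝ), N.IsLPOptimal lam mu qbar ς τ R →
          (∃ s : UAV.Schedule K, N.IsHovering lam mu qbar ς τ s) ∧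
          ∀ s : UAV.Schedule K, N.IsHovering lam mu qbar ς τ s →
            N.IsEpiOptimal s R ∧ N.IsOptimal s ∧ N.commonThroughput s = R := by
  refine ⟨N.exists_isDualOptimal hK, fun lam mu hopt => ?_⟩
  have hmu := hopt.mu_pos hK
  refine ⟨hmu, N.maximizers_finite hK hmu, N.maximizers_nonempty hK hmu, fun Ω qbar _ hq => ?_⟩
  obtain ⟨V, -, hV, -⟩ := hopt.exists_value hK
  obtain ⟨ς₀, τ₀, hfeas₀⟩ := hopt.exists_lpFeasible hK hV hq
  have hweak : ∀ s R, N.EpiFeasible s R → R ≤ N.T * V := fun s R h =>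
    EReal.coe_le_coe_iff.1 (hV ▸ h.le_dual hopt.1)
  refine ⟨⟨ς₀, τ₀, N.T * V, hfeas₀, fun ς τ R h => ?_⟩, fun ς τ R hlp => ?_⟩
  -- A point of the linear program becomes a feasible schedule, so weak duality also bounds the
  -- linear program.
  · obtain ⟨s, hs⟩ := N.exists_isHovering (lam := lam) (mu := mu) (qbar := qbar)
      h.ς_nonneg h.τ_nonneg
    exact hweak s R (h.epiFeasible hs)
  · refine ⟨N.exists_isHovering hlp.1.ς_nonneg hlp.1.τ_nonneg, fun s hs => ?_⟩
    have hepi : N.IsEpiOptimal s R := ⟨hlp.1.epiFeasible hs, fun s' R' h' =>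
      (hweak s' R' h').trans (hlp.2 _ _ _ hfeas₀)⟩
    exact ⟨hepi, hepi.isOptimal hK, hepi.commonThroughput_eq hK⟩
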